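/- **Definitions.** A metric on a group $G$ is bi-invariant if it is invariant under all left and right translations. A *metric family of groups* $\mathcal{G}=\{(G_i,d_i):i\in I\}$ consists of nontrivial groups $G_i$ with bi-invariant metrics $d_i$ of uniformly bounded diameter. A group $\Gamma$ is *$\mathcal{G}$-approximable* if there is $c>0$ such that for every finite $F\subseteq\Gamma$ and every $\epsilon>0$ there are $i\in I$ and a function $\varphi:\Gamma\to G_i$ which is unital ($\varphi(e)=e$), $(F,\epsilon)$-multiplicative ($d_i(\varphi(gh),\varphi(g)\varphi(h))<\epsilon$ for all $g,h\in F$ with $gh\in F$), and $(F,c)$-separating ($d_i(\varphi(g),e)>c$ for all $e\neq g\in F$). A group is * *sofic* if it is approximable by the family of nontrivial groups $\mathrm{Sym}(n)$, $n\in\mathbb{N}$, with the normalized Hamming metrics $d_n(\sigma,\tau)=\frac1n|\{a:\sigma(a)\neq\tau(a)\}|$; * *$\mathbb{K}$-linear sofic*, for a field $\mathbb{K}$, if it is approximable by the family of nontrivial groups $\mathrm{GL}_n(\mathbb{K})$, $n\in\mathbb{N}$, with the metrics $d(M,N)=\frac1n\operatorname{rk}(M-N)$; * *hyperlinear* if it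 is approximable by the family of nontrivial unitary groups $U(n)$, $n\in\mathbb{N}$, with the metrics $d(A,B)=\sqrt{\frac1n\sum_{i,j}|A_{ij}-B_{ij}|^2}$; * *weakly sofic* if it is approximable by the family of all finite groups equipped with bi-invariant metrics of diameter one. For groups $\Delta,\Lambda$ and a finite set $E\subseteq\Delta$, a function $\pi:E\to\Lambda$ is a *partial homomorphism* if $\pi(gh)=\pi(g)\pi(h)$ whenever $g,h,gh\in E$. Let $\mathcal{C}$ be a class of groups. A homomorphism $\beta:\Gamma\to\mathrm{Aut}(\Delta)$ is a *sofic $\mathcal{C}$-action* if for all finite $F\subseteq\Gamma$, $E\subseteq\Delta$ and all $\epsilon>0$ there are a group $\Lambda\in\mathcal{C}$, a finite set $A$, a unital function $\varphi:\Gamma\to\mathrm{Sym}(A)$ which is $(F,\epsilon)$-multiplicative for the normalized Hamming metric on $\mathrm{Sym}(A)$, a subset $S\subseteq A$ with $|S|>(1-\epsilon)|A|$, and injective partial homomorphisms $\pi_s:E\hookrightarrow\Lambda$ ($s\in S$), such that for all $g\in F$, $h\in E$, $s\in S$ with $\varphi(g)\cdot s\in S$ and $\beta(g)^{-1}[h]\in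 E$ we have $$\pi_{\varphi(g)\cdot s}(h)=\pi_s(\beta(g)^{-1}[h]).$$ **Statement.** Let $\mathcal{C}$ be one of the following classes of groups: (a) the sofic groups; (b) the $\mathbb{K}$-linear sofic groups, for any field $\mathbb{K}$; (c) the hyperlinear groups; (d) the weakly sofic groups. Let $\Gamma,\Delta\in\mathcal{C}$ and let $\beta:\Gamma\to\mathrm{Aut}(\Delta)$ be a sofic $\mathcal{C}$-action. Then $\Delta\rtimes_\beta\Gamma\in\mathcal{C}$. -/

import Mathlib

/-! Metric approximations of groups and sofic actions by automorphisms. -/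

universe u v w x

namespace MetricApprox

/-- `d` is a bi-invariant metric on the group `G`. -/
structure IsBiinvariantMetric {G : Type v} [Group G] (d : G → G → ℝ) : Prop where
  self : ∀ g, d g g = 0
  eq_of_dist_eq_zero : ∀ {g h}, d g h = 0 → g = h
  symm : ∀ g h, d g h = d h g
  triangle : ∀ g h k, d g k ≤ d g h + d h k
  mul_left : ∀ a g h, d (a * g) (a * h) = d g h
  mul_right : ∀ a g h, d (g * a) (h * a) = d g h

set_option linter.checkUnivs false in
/-- A metric family of groups: nontrivial groups with bi-invariant metrics of uniformly bounded
diameter. -/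
structure MetricFamily where
  /-- the index set -/
  Idx : Type u
  /-- the groups of the family -/
  G : Idx → Type v
  [group : ∀ i, Group (G i)]
  [nontrivial : ∀ i, Nontrivial (G i)]
  /-- the metrics of the family -/
  dist : ∀ i, G i → G i → ℝ
  isBiinvariantMetric : ∀ i, IsBiinvariantMetric (dist i)
  bounded : ∃ D : ℝ, ∀ i g h, dist i g h ≤ D

attribute [instance] MetricFamily.group MetricFamily.nontrivial

section Representations

variable {Γ : Type w} [Group Γ] {G : Type v} [Group G]

/-- `φ` is `(F, ε)`-multiplicative with respect to `d`. -/
def IsMultiplicativeOn (d : G → G → ℝ) (F : Finset Γ) (ε : ℝ) (φ : Γ → G) : Prop :=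
  ∀ g ∈ F, ∀ h ∈ F, g * h ∈ F → d (φ (g * h)) (φ g * φ h) < ε

/-- `φ` is `(F, c)`-separating with respect to `d`. -/
def IsSeparatingOn (d : G → G → ℝ) (F : Finset Γ) (c : ℝ) (φ : Γ → G) : Prop :=
  ∀ g ∈ F, g ≠ 1 → c < d (φ g) 1

/-- `φ` is unital. -/
def IsUnital (φ : Γ → G) : Prop := φ 1 = 1

end Representations

/-- `Γ` is `(𝒢, c)`-approximable: for all finite `F` and all `ε > 0` there is an
`(F, ε, c)`-`𝒢`-representation of `Γ`. -/
def MetricFamily.IsApproximableWith (𝒢 : MetricFamily.{u, v}) (c : ℝ)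
    (Γ : Type w) [Group Γ] : Prop :=
  ∀ (F : Finset Γ) (ε : ℝ), 0 < ε → ∃ (i : 𝒢.Idx) (φ : Γ → 𝒢.G i),
    IsMultiplicativeOn (𝒢.dist i) F ε φ ∧ IsSeparatingOn (𝒢.dist i) F c φ ∧ IsUnital φ

/-- `Γ` is `𝒢`-approximable. -/
def MetricFamily.IsApproximable (𝒢 : MetricFamily.{u, v}) (Γ : Type w) [Group Γ] : Prop :=
  ∃ c : ℝ, 0 < c ∧ 𝒢.IsApproximableWith c Γ

section Sofic

/-- The normalized Hamming metric on `Sym(A)`: the proportion of points of `A` at which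
`σ` and `τ` differ. -/
noncomputable def hammingMetric {A : Type v} [Fintype A] [DecidableEq A]
    (σ τ : Equiv.Perm A) : ℝ :=
  (hammingDist (σ : A → A) (τ : A → A) : ℝ) / Fintype.card A

theorem isBiinvariantMetric_hammingMetric {A : Type v} [Fintype A] [DecidableEq A] [Nonempty A] :
    IsBiinvariantMetric (hammingMetric (A := A)) where
  self g := by simp [hammingMetric]
  eq_of_dist_eq_zero {g h} H := by
    have : hammingDist (g : A → A) (h : A → A) = 0 := by
      simpa [hammingMetric] using H
    exact DFunLike.coe_injective (hammingDist_eq_zero.1 this)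
  symm g h := by simp only [hammingMetric, hammingDist_comm]
  triangle g h k := by
    unfold hammingMetric
    rw [← add_div]
    have := hammingDist_triangle (g : A → A) (h : A → A) (k : A → A)
    gcongr
    exact_mod_cast this
  mul_left a g h := by
    unfold hammingMetric
    congr 2
    exact hammingDist_comp (fun _ => a) (x := (g : A → A)) (y := (h : A → A))
      (fun _ => a.injective)
  mul_right a g h := by
    unfold hammingMetric
    congr 2
    refine Finset.card_bij (fun x _ => a x) ?_ (fun _ _ _ _ H => a.injective H) ?_
    · intro x hx
      exact Finset.mem_filter.2 ⟨Finset.mem_univ _, (Finset.mem_filter.1 hx).2⟩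
    · intro y hy
      refine ⟨a.symm y, Finset.mem_filter.2 ⟨Finset.mem_univ _, ?_⟩, by simp⟩
      simpa using (Finset.mem_filter.1 hy).2

theorem hammingMetric_le_one {A : Type v} [Fintype A] [DecidableEq A] (σ τ : Equiv.Perm A) :
    hammingMetric σ τ ≤ 1 := by
  unfold hammingMetric
  refine div_le_one_of_le₀ ?_ (by positivity)
  exact_mod_cast hammingDist_le_card_fintype

/-- The groups `Sym(n)` (those that are nontrivial) with the normalized Hamming metrics. -/
noncomputable def soficFamily : MetricFamily.{0, 0} where
  Idx := {n : ℕ // Nontrivial (Equiv.Perm (Fin n))}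
  G i := Equiv.Perm (Fin i.1)
  nontrivial i := i.2
  dist _ := hammingMetric
  isBiinvariantMetric := by
    rintro ⟨_ | n, hn⟩
    · exact absurd hn (not_nontrivial _)
    · exact isBiinvariantMetric_hammingMetric
  bounded := ⟨1, fun _ => hammingMetric_le_one⟩

/-- Sofic groups. -/
def IsSofic (Γ : Type w) [Group Γ] : Prop := soficFamily.IsApproximable Γ

end Sofic

section LinearSofic

variable (K : Type u) [Field K]

/-- The normalized rank metric on `GL_n(K)`. -/
noncomputable def rankMetric (n : ℕ) (M N : GL (Fin n) K) : ℝ :=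
  (((M : Matrix (Fin n) (Fin n) K) - (N : Matrix (Fin n) (Fin n) K)).rank : ℝ) / n

variable {K} in
theorem rank_eq_zero {n : ℕ} {A : Matrix (Fin n) (Fin n) K} (h : A.rank = 0) : A = 0 := by
  rw [Matrix.rank, Submodule.finrank_eq_zero, LinearMap.range_eq_bot] at h
  ext i j
  have := congrFun (LinearMap.congr_fun h (Pi.single j 1)) i
  simpa using this

variable {K} in
theorem rank_add_le {n : ℕ} (A B : Matrix (Fin n) (Fin n) K) :
    (A + B).rank ≤ A.rank + B.rank := by
  unfold Matrix.rank
  rw [Matrix.mulVecLin_add]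
  refine (Submodule.finrank_mono ?_).trans (Submodule.finrank_add_le_finrank_add_finrank _ _)
  exact LinearMap.range_add_le _ _

variable {K} in
theorem isBiinvariantMetric_rankMetric {n : ℕ} (hn : n ≠ 0) :
    IsBiinvariantMetric (rankMetric K n) where
  self g := by simp [rankMetric]
  eq_of_dist_eq_zero {g h} H := by
    have hr : ((g : Matrix (Fin n) (Fin n) K) - h).rank = 0 := by
      simpa [rankMetric, hn] using H
    exact Units.ext (sub_eq_zero.1 (rank_eq_zero hr))
  symm g h := by
    unfold rankMetric
    rw [← neg_sub (h : Matrix (Fin n) (Fin n) K), ← neg_one_mul,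
      Matrix.rank_mul_eq_right_of_isUnit_det]
    simp [Matrix.det_neg]
  triangle g h k := by
    unfold rankMetric
    rw [← add_div]
    have := rank_add_le (g.1 - h.1) (h.1 - k.1)
    rw [sub_add_sub_cancel] at this
    gcongr
    exact_mod_cast this
  mul_left a g h := by
    unfold rankMetric
    rw [Units.val_mul, Units.val_mul, ← mul_sub, Matrix.rank_mul_eq_right_of_isUnit_det]
    exact (Matrix.isUnit_iff_isUnit_det _).1 a.isUnit
  mul_right a g h := by
    unfold rankMetric
    rw [Units.val_mul, Units.val_mul, ← sub_mul, Matrix.rank_mul_eq_left_of_isUnit_det]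
    exact (Matrix.isUnit_iff_isUnit_det _).1 a.isUnit

theorem rankMetric_le_one (n : ℕ) (M N : GL (Fin n) K) : rankMetric K n M N ≤ 1 := by
  unfold rankMetric
  refine div_le_one_of_le₀ ?_ (by positivity)
  exact_mod_cast Matrix.rank_le_height _

/-- The groups `GL_n(K)` (those that are nontrivial) with the normalized rank metrics. -/
noncomputable def linearSoficFamily : MetricFamily.{0, u} where
  Idx := {n : ℕ // Nontrivial (GL (Fin n) K)}
  G i := GL (Fin i.1) K
  nontrivial i := i.2
  dist i := rankMetric K i.1
  isBiinvariantMetric := by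
    rintro ⟨n, hn⟩
    refine isBiinvariantMetric_rankMetric ?_
    rintro rfl
    exact absurd hn (not_nontrivial _)
  bounded := ⟨1, fun i => rankMetric_le_one K i.1⟩

/-- `K`-linear sofic groups. -/
def IsLinearSofic (Γ : Type w) [Group Γ] : Prop := (linearSoficFamily K).IsApproximable Γ

end LinearSofic

section Hyperlinear

/-- The normalized Hilbert-Schmidt metric on `U(n)`. -/
noncomputable def hsMetric (n : ℕ) (A B : Matrix.unitaryGroup (Fin n) ℂ) : ℝ :=
  √((1 / n : ℝ) * ∑ i, ∑ j, ‖A.1 i j - B.1 i j‖ ^ 2)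

/-- The Euclidean norm of a square matrix. -/
noncomputable def euclNorm {n : ℕ} (X : Matrix (Fin n) (Fin n) ℂ) : ℝ :=
  ‖WithLp.toLp 2 (fun p : Fin n × Fin n => X p.1 p.2)‖

theorem euclNorm_eq {n : ℕ} (X : Matrix (Fin n) (Fin n) ℂ) :
    euclNorm X = √(∑ i, ∑ j, ‖X i j‖ ^ 2) := by
  rw [euclNorm, EuclideanSpace.norm_eq, Fintype.sum_prod_type]

theorem euclNorm_add_le {n : ℕ} (X Y : Matrix (Fin n) (Fin n) ℂ) :
    euclNorm (X + Y) ≤ euclNorm X + euclNorm Y :=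
  norm_add_le (WithLp.toLp 2 (fun p : Fin n × Fin n => X p.1 p.2))
    (WithLp.toLp 2 (fun p : Fin n × Fin n => Y p.1 p.2))

theorem sum_sq_eq_trace {n : ℕ} (X : Matrix (Fin n) (Fin n) ℂ) :
    ((∑ i, ∑ j, ‖X i j‖ ^ 2 : ℝ) : ℂ) = (X * star X).trace := by
  simp [Matrix.trace, Matrix.mul_apply, Matrix.star_apply, Complex.mul_conj,
    Complex.normSq_eq_norm_sq]

theorem euclNorm_mul_left {n : ℕ} (U : Matrix.unitaryGroup (Fin n) ℂ)
    (X : Matrix (Fin n) (Fin n) ℂ) : euclNorm (U.1 * X) = euclNorm X := by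
  rw [euclNorm_eq, euclNorm_eq]
  congr 1
  apply Complex.ofReal_injective
  rw [sum_sq_eq_trace, sum_sq_eq_trace, star_mul, ← mul_assoc, Matrix.trace_mul_comm,
    ← mul_assoc, ← mul_assoc, Matrix.UnitaryGroup.star_mul_self, one_mul]

theorem euclNorm_mul_right {n : ℕ} (U : Matrix.unitaryGroup (Fin n) ℂ)
    (X : Matrix (Fin n) (Fin n) ℂ) : euclNorm (X * U.1) = euclNorm X := by
  rw [euclNorm_eq, euclNorm_eq]
  congr 1
  apply Complex.ofReal_injective
  rw [sum_sq_eq_trace, sum_sq_eq_trace, star_mul, mul_assoc, ← mul_assoc U.1,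
    Matrix.mem_unitaryGroup_iff.1 U.2, one_mul]

theorem hsMetric_eq {n : ℕ} (A B : Matrix.unitaryGroup (Fin n) ℂ) :
    hsMetric n A B = √(1 / n : ℝ) * euclNorm (A.1 - B.1) := by
  rw [hsMetric, Real.sqrt_mul (by positivity), euclNorm_eq]
  rfl

theorem isBiinvariantMetric_hsMetric {n : ℕ} (hn : n ≠ 0) :
    IsBiinvariantMetric (hsMetric n) where
  self g := by simp [hsMetric]
  eq_of_dist_eq_zero {g h} H := by
    have h0 : √(1 / n : ℝ) ≠ 0 := by positivity
    rw [hsMetric_eq] at H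
    have H2 := norm_eq_zero.1 ((mul_eq_zero.1 H).resolve_left h0)
    refine Subtype.ext (Matrix.ext fun i j => sub_eq_zero.1 ?_)
    exact congrFun (congrArg WithLp.ofLp H2) (i, j)
  symm g h := by
    unfold hsMetric
    simp only [norm_sub_rev]
  triangle g h k := by
    simp only [hsMetric_eq]
    rw [← mul_add, ← sub_add_sub_cancel g.1 h.1 k.1]
    gcongr
    exact euclNorm_add_le _ _
  mul_left a g h := by
    simp only [hsMetric_eq, Matrix.UnitaryGroup.mul_val, ← mul_sub, euclNorm_mul_left]
  mul_right a g h := by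
    simp only [hsMetric_eq, Matrix.UnitaryGroup.mul_val, ← sub_mul, euclNorm_mul_right]

theorem hsMetric_le_two (n : ℕ) (A B : Matrix.unitaryGroup (Fin n) ℂ) : hsMetric n A B ≤ 2 := by
  rcases Nat.eq_zero_or_pos n with rfl | hn
  · simp [hsMetric]
  have key : ∀ U : Matrix.unitaryGroup (Fin n) ℂ, euclNorm U.1 = √n := by
    intro U
    rw [euclNorm_eq]
    congr 1
    apply Complex.ofReal_injective
    rw [sum_sq_eq_trace, Matrix.mem_unitaryGroup_iff.1 U.2]
    simp
  have hB : euclNorm (-B.1) = √n := by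
    rw [← key B, euclNorm_eq, euclNorm_eq]
    simp
  have h1 : euclNorm (A.1 - B.1) ≤ √n + √n := by
    rw [sub_eq_add_neg]
    exact (euclNorm_add_le _ _).trans (by rw [key, hB])
  rw [hsMetric_eq]
  have h2 : √(1 / n : ℝ) * √n = 1 := by
    rw [← Real.sqrt_mul (by positivity), one_div_mul_cancel (by positivity), Real.sqrt_one]
  calc √(1 / n : ℝ) * euclNorm (A.1 - B.1) ≤ √(1 / n : ℝ) * (√n + √n) := by gcongr
    _ = 2 := by rw [mul_add, h2]; norm_num

/-- The groups `U(n)` (those that are nontrivial) with the normalized Hilbert-Schmidt metrics. -/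
noncomputable def hyperlinearFamily : MetricFamily.{0, 0} where
  Idx := {n : ℕ // Nontrivial (Matrix.unitaryGroup (Fin n) ℂ)}
  G i := Matrix.unitaryGroup (Fin i.1) ℂ
  nontrivial i := i.2
  dist i := hsMetric i.1
  isBiinvariantMetric := by
    rintro ⟨n, hn⟩
    refine isBiinvariantMetric_hsMetric ?_
    rintro rfl
    exact absurd hn (not_nontrivial _)
  bounded := ⟨2, fun i => hsMetric_le_two i.1⟩

/-- Hyperlinear groups. -/
def IsHyperlinear (Γ : Type w) [Group Γ] : Prop := hyperlinearFamily.IsApproximable Γ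

end Hyperlinear

section WeaklySofic

/-- A finite group with a bi-invariant metric of diameter one. -/
structure FiniteMetricGroup where
  /-- the group -/
  carrier : Type
  [group : Group carrier]
  [finite : Finite carrier]
  /-- the metric -/
  dist : carrier → carrier → ℝ
  isBiinvariantMetric : IsBiinvariantMetric dist
  dist_le_one : ∀ g h, dist g h ≤ 1
  exists_dist_eq_one : ∃ g h, dist g h = 1

attribute [instance] FiniteMetricGroup.group FiniteMetricGroup.finite

/-- All finite groups equipped with bi-invariant metrics of diameter one. -/
def weaklySoficFamily : MetricFamily.{1, 0} where
  Idx := FiniteMetricGroup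
  G i := i.carrier
  nontrivial i := by
    obtain ⟨g, h, hgh⟩ := i.exists_dist_eq_one
    refine ⟨g, h, ?_⟩
    rintro rfl
    rw [i.isBiinvariantMetric.self] at hgh
    exact zero_ne_one hgh
  dist i := i.dist
  isBiinvariantMetric i := i.isBiinvariantMetric
  bounded := ⟨1, fun i => i.dist_le_one⟩

/-- Weakly sofic groups. -/
def IsWeaklySofic (Γ : Type w) [Group Γ] : Prop := weaklySoficFamily.IsApproximable Γ

end WeaklySofic

section SoficActions

variable {Γ : Type u} [Group Γ] {Δ : Type v} [Group Δ]

/-- The restriction of `π` to `E` is an injective partial homomorphism `E ↪ Λ`. -/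
def IsInjPartialHomOn {Λ : Type w} [Group Λ] (E : Finset Δ) (π : Δ → Λ) : Prop :=
  Set.InjOn π (E : Set Δ) ∧ ∀ g ∈ E, ∀ h ∈ E, g * h ∈ E → π (g * h) = π g * π h

/-- `φ` is an `(F, E, ε, Λ)`-automorphic approximation of `β`. Only the values of `π s` on `E`
for `s ∈ S` matter. -/
def IsAutomorphicApprox (β : Γ →* MulAut Δ) {A : Type} [Fintype A] (φ : Γ → Equiv.Perm A)
    (F : Finset Γ) (E : Finset Δ) (ε : ℝ) (Λ : Type w) [Group Λ] : Prop :=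
  ∃ (S : Finset A) (π : A → Δ → Λ),
    (1 - ε) * (Fintype.card A : ℝ) < (S.card : ℝ) ∧
    (∀ s ∈ S, IsInjPartialHomOn E (π s)) ∧
    ∀ g ∈ F, ∀ h ∈ E, ∀ s ∈ S, φ g s ∈ S → (β g)⁻¹ h ∈ E →
      π (φ g s) h = π s ((β g)⁻¹ h)

/-- `β` is a sofic `C`-action by automorphisms, for a class `C` of groups. -/
def IsSoficAction (C : ∀ (Λ : Type w) [Group Λ], Prop) (β : Γ →* MulAut Δ) : Prop :=
  ∀ (F : Finset Γ) (E : Finset Δ) (ε : ℝ), 0 < ε →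
    ∃ (Λ : Type w) (_ : Group Λ) (A : Type) (_ : Fintype A) (_ : DecidableEq A)
      (φ : Γ → Equiv.Perm A),
      C Λ ∧ IsUnital φ ∧ IsMultiplicativeOn hammingMetric F ε φ ∧
        IsAutomorphicApprox β φ F E ε Λ

end SoficActions

end MetricApprox

/-! Write the length of an element for its distance to the identity. Given `(F, ε)`, the sofic
action supplies a finite set `A`, an almost-action `φ` on `A`, a group `Λ` in the class and partial
embeddings `π_s` of a finite piece of `Δ` into `Λ`. Composing each `π_s` with an approximation `ψ`
of `Λ` in some `G` turns an element of `Δ` into a function `A → G`, and `φ` turns an element of `Γ`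
into a permutation of `A`. The equivariance of the `π_s` says exactly that these two pieces almost
satisfy the relations of the wreath product of `G` by `Sym(A)`. An independent approximation `ρ` of
`Γ` is added as a second factor, because `φ` is not required to separate points of `Γ`. The elements
with nontrivial `Γ`-part are separated by `ρ`, the others by `ψ` averaged over `A`.

To land in the family again, three closure properties of its length functions suffice. Wreath
products by `Sym(A)` and binary products must embed with comparable lengths. The upper bounds for
wreath products are stated for squares because Hilbert-Schmidt lengths average quadratically. The
third property, a homomorphism expanding small lengths, is needed because `Λ` changes with `(F, ε)`
and comes with its own separation constant. Combined with products it gives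
`IsApproximable.amplify`, which makes the constant `1 / 12` for every approximable group.
`IsApproximable.semidirectProduct` is then the common theorem.

What remains is to check the properties in the four families. Block-diagonal and block-permutation
constructions give wreath products, repeated blocks give products of equal weight, and tensor
squares give expansion. In the weakly sofic family one is free to choose the metric, so there the
wreath product, the product and a truncated doubled metric are used directly. -/

namespace MetricApprox

/-! ### Lengths for bi-invariant metrics. -/

section BiinvariantMetric

variable {G : Type v} [Group G] {d : G → G → ℝ}

theorem IsBiinvariantMetric.nonneg (hd : IsBiinvariantMetric d) (g h : G) : 0 ≤ d g h := by
  have h1 := hd.triangle g h g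
  rw [hd.self, hd.symm h g] at h1
  linarith

theorem IsBiinvariantMetric.eq_mul_inv (hd : IsBiinvariantMetric d) (g h : G) :
    d g h = d (g * h⁻¹) 1 := by
  rw [← hd.mul_right h⁻¹ g h, mul_inv_cancel]

/-- This is why the closure properties below only control lengths of homomorphic images: distances
between images follow. -/
theorem IsBiinvariantMetric.map_eq {H : Type w} [Group H] (hd : IsBiinvariantMetric d)
    (f : H →* G) (x y : H) : d (f x) (f y) = d (f (x * y⁻¹)) 1 := by
  rw [hd.eq_mul_inv, map_mul, map_inv]

theorem IsBiinvariantMetric.mul_mul_le (hd : IsBiinvariantMetric d) (a b a' b' : G) :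
    d (a * b) (a' * b') ≤ d a a' + d b b' := by
  have := hd.triangle (a * b) (a' * b) (a' * b')
  rwa [hd.mul_right, hd.mul_left] at this

end BiinvariantMetric

/-! ### Closure properties of length functions. -/

section Containment

variable {G : Type*} [Group G] {G' : Type*} [Group G'] {H : Type*} [Group H] {H' : Type*} [Group H']

/-- The permutational wreath product of a group of length `l` by `Sym(A)` is represented in a group
of length `m`, the lengths of functions on `A` being comparable to averages. -/
def ContainsWreathProduct (l : G → ℝ) (A : Type) [Fintype A] [DecidableEq A] (m : H → ℝ) : Prop :=
  ∃ (D : (A → G) →* H) (P : Equiv.Perm A →* H),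
    (∀ σ f, P σ * D f = D (fun a => f (σ⁻¹ a)) * P σ) ∧
    (∀ f, (∑ a, l (f a)) / Fintype.card A ≤ m (D f)) ∧
    (∀ f, m (D f) ^ 2 ≤ 2 * ((∑ a, l (f a)) / Fintype.card A)) ∧
    ∀ σ, m (P σ) ^ 2 ≤ 2 * hammingMetric σ 1

/-- The product of groups of lengths `l` and `l'` is represented in a group of length `m`. -/
def ContainsProduct (l : G → ℝ) (l' : G' → ℝ) (m : H → ℝ) : Prop :=
  ∃ Q : G × G' →* H, ∀ x, (l x.1 + l' x.2) / 2 ≤ m (Q x) ∧ m (Q x) ≤ l x.1 + l' x.2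

/-- A group of length `l` is represented in a group of length `m` in such a way that small lengths
are expanded. -/
def ContainsExpansion (l : G → ℝ) (m : H → ℝ) : Prop :=
  ∃ t : G →* H, ∀ x, m (t x) ≤ 2 * l x ∧ (l x ≤ 1 / 6 → 5 / 4 * l x ≤ m (t x))

variable {l : G → ℝ} {l' : G' → ℝ} {m : H → ℝ} {m' : H' → ℝ}

theorem ContainsWreathProduct.map {A : Type} [Fintype A] [DecidableEq A] (e : H →* H')
    (he : ∀ x, m' (e x) = m x) (h : ContainsWreathProduct l A m) :
    ContainsWreathProduct l A m' := by
  obtain ⟨D, P, h1, h2, h3, h4⟩ := h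
  refine ⟨e.comp D, e.comp P, fun σ f => ?_, ?_, ?_, ?_⟩
  · simp only [MonoidHom.comp_apply]
    rw [← map_mul, ← map_mul, h1]
  all_goals simpa only [MonoidHom.comp_apply, he]

theorem ContainsProduct.map (e : H →* H') (he : ∀ x, m' (e x) = m x)
    (h : ContainsProduct l l' m) : ContainsProduct l l' m' := by
  obtain ⟨Q, hQ⟩ := h
  exact ⟨e.comp Q, by simpa only [MonoidHom.comp_apply, he]⟩

theorem ContainsExpansion.map (e : H →* H') (he : ∀ x, m' (e x) = m x)
    (h : ContainsExpansion l m) : ContainsExpansion l m' := by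
  obtain ⟨t, ht⟩ := h
  exact ⟨e.comp t, by simpa only [MonoidHom.comp_apply, he]⟩

end Containment

/-! ### Amplification of the separation constant, and the semidirect product. -/

namespace MetricFamily

variable (𝒢 : MetricFamily.{u, v})

/-- The length of an element: its distance to the identity. -/
def len (i : 𝒢.Idx) (g : 𝒢.G i) : ℝ := 𝒢.dist i g 1

variable {𝒢} in
theorem len_nonneg {i : 𝒢.Idx} (g : 𝒢.G i) : 0 ≤ 𝒢.len i g :=
  (𝒢.isBiinvariantMetric i).nonneg g 1

/-- The family contains, up to a controlled change of metric, permutational wreath products by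
finite symmetric groups. -/
def AdmitsWreathProducts : Prop :=
  ∀ (i : 𝒢.Idx) (A : Type) [Fintype A] [DecidableEq A] [Nonempty A],
    ∃ j : 𝒢.Idx, ContainsWreathProduct (𝒢.len i) A (𝒢.len j)

/-- The family contains, up to a controlled change of metric, products of two of its members. -/
def AdmitsProducts : Prop :=
  ∀ i i' : 𝒢.Idx, ∃ j : 𝒢.Idx, ContainsProduct (𝒢.len i) (𝒢.len i') (𝒢.len j)

/-- Every member of the family has a homomorphism to another one which expands small lengths. -/
def AdmitsExpansions : Prop :=
  ∀ i : 𝒢.Idx, ∃ j : 𝒢.Idx, ContainsExpansion (𝒢.len i) (𝒢.len j)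

variable {𝒢}

theorem IsApproximableWith.mono {c c' : ℝ} {Γ : Type w} [Group Γ] (hc : c' ≤ c)
    (h : 𝒢.IsApproximableWith c Γ) : 𝒢.IsApproximableWith c' Γ := by
  intro F ε hε
  obtain ⟨i, φ, h1, h2, h3⟩ := h F ε hε
  exact ⟨i, φ, h1, fun g hg hg1 => hc.trans_lt (h2 g hg hg1), h3⟩

/-- The expansion `t` alone may destroy long elements, as the tensor square kills `-1`, so it is
paired with the identity. A length `l ≤ 1 / 6` becomes at least `(1 + 5 / 4) / 2 * l`, while a
longer one stays above half of `1 / 6`. -/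
theorem IsApproximableWith.amplify_once (hQ : 𝒢.AdmitsProducts) (hT : 𝒢.AdmitsExpansions)
    {c : ℝ} {Γ : Type w} [Group Γ] (h : 𝒢.IsApproximableWith c Γ) :
    𝒢.IsApproximableWith (min (9 / 8 * c) (1 / 12)) Γ := by
  intro F ε hε
  obtain ⟨i, φ, h1, h2, h3⟩ := h F (ε / 3) (by positivity)
  obtain ⟨j, t, ht⟩ := hT i
  obtain ⟨k, Q, hQ⟩ := hQ i j
  let θ : 𝒢.G i →* 𝒢.G k := Q.comp ((MonoidHom.id _).prod t)
  have hθ1 (x) : 𝒢.len k (θ x) ≤ 3 * 𝒢.len i x := by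
    have h4 : 𝒢.len k (θ x) ≤ 𝒢.len i x + 𝒢.len j (t x) := (hQ (x, t x)).2
    linarith [(ht x).1]
  have hθ2 (x) : (𝒢.len i x + 𝒢.len j (t x)) / 2 ≤ 𝒢.len k (θ x) := (hQ (x, t x)).1
  refine ⟨k, fun g => θ (φ g), ?_, ?_, ?_⟩
  · intro g hg h hh hgh
    have h4 := h1 g hg h hh hgh
    have h5 := hθ1 (φ (g * h) * (φ g * φ h)⁻¹)
    rw [len, len, ← (𝒢.isBiinvariantMetric i).eq_mul_inv,
      ← (𝒢.isBiinvariantMetric k).map_eq, map_mul] at h5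
    linarith
  · intro g hg hg1
    have h4 : c < 𝒢.len i (φ g) := h2 g hg hg1
    have h5 := hθ2 (φ g)
    change _ < 𝒢.len k (θ (φ g))
    by_cases h6 : 𝒢.len i (φ g) ≤ 1 / 6
    · have h7 := (ht (φ g)).2 h6
      exact (min_le_left _ _).trans_lt (by linarith)
    · have h7 := len_nonneg (t (φ g))
      exact (min_le_right _ _).trans_lt (by linarith)
  · change θ (φ 1) = 1
    rw [h3, map_one]

/-- The separation constant of an approximable group can be chosen independently of the group. -/
theorem IsApproximable.amplify (hQ : 𝒢.AdmitsProducts) (hT : 𝒢.AdmitsExpansions)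
    {Γ : Type w} [Group Γ] (h : 𝒢.IsApproximable Γ) : 𝒢.IsApproximableWith (1 / 12) Γ := by
  obtain ⟨c, hc, h⟩ := h
  have key : ∀ n : ℕ, 𝒢.IsApproximableWith (min ((9 / 8) ^ n * c) (1 / 12)) Γ := by
    intro n
    induction n with
    | zero => exact h.mono (by simp)
    | succ n ih =>
      refine (ih.amplify_once hQ hT).mono (le_min ?_ (min_le_right _ _))
      -- The cap `1 / 12` is stable: one more factor `9 / 8` only raises it.
      rw [mul_min_of_nonneg _ _ (by norm_num : (0 : ℝ) ≤ 9 / 8)]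
      refine le_min ((min_le_left _ _).trans (by rw [pow_succ']; linarith)) ?_
      exact (min_le_right _ _).trans (by norm_num)
  obtain ⟨n, hn⟩ := pow_unbounded_of_one_lt (1 / 12 / c) (by norm_num : (1 : ℝ) < 9 / 8)
  refine (key n).mono (le_min ?_ le_rfl)
  rw [div_lt_iff₀ hc] at hn
  exact hn.le

/-- An average of lengths is small if most lengths are small. -/
theorem average_le {A : Type x} [Fintype A] [Nonempty A] {S : Finset A} {x : A → ℝ} {a b K : ℝ}
    (hb : 0 ≤ b) (hK : 0 ≤ K) (h1 : ∀ s ∈ S, x s ≤ b) (h2 : ∀ s, x s ≤ K)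
    (h3 : (1 - a) * Fintype.card A ≤ S.card) :
    (∑ s, x s) / Fintype.card A ≤ b + a * K := by
  classical
  have hA : (0 : ℝ) < Fintype.card A := by exact_mod_cast Fintype.card_pos
  rw [div_le_iff₀ hA, ← Finset.sum_add_sum_compl S]
  have h4 : ∑ s ∈ S, x s ≤ S.card * b := by
    simpa using Finset.sum_le_sum h1
  have h5 : ∑ s ∈ Sᶜ, x s ≤ (Sᶜ.card : ℝ) * K := by
    simpa using Finset.sum_le_sum (s := Sᶜ) fun s _ => h2 s
  have h6 : (Sᶜ.card : ℝ) = Fintype.card A - S.card := by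
    rw [Finset.card_compl, Nat.cast_sub (Finset.card_le_univ _)]
  have h7 : (S.card : ℝ) ≤ Fintype.card A := by exact_mod_cast Finset.card_le_univ S
  rw [h6] at h5
  nlinarith

theorem le_average {A : Type x} [Fintype A] [Nonempty A] {S : Finset A} {x : A → ℝ} {a c : ℝ}
    (hc : 0 ≤ c) (h1 : ∀ s ∈ S, c ≤ x s) (h2 : ∀ s, 0 ≤ x s)
    (h3 : a * Fintype.card A ≤ S.card) :
    a * c ≤ (∑ s, x s) / Fintype.card A := by
  have hA : (0 : ℝ) < Fintype.card A := by exact_mod_cast Fintype.card_pos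
  rw [le_div_iff₀ hA]
  have h4 : S.card * c ≤ ∑ s ∈ S, x s := by
    simpa using Finset.sum_le_sum h1
  have h5 : ∑ s ∈ S, x s ≤ ∑ s, x s :=
    Finset.sum_le_sum_of_subset_of_nonneg (Finset.subset_univ _) fun s _ _ => h2 s
  nlinarith

theorem exists_small_parameter {ε K : ℝ} (hε : 0 < ε) (hK : 0 ≤ K) :
    ∃ η : ℝ, 0 < η ∧ η ≤ ε / 4 ∧ η ≤ 1 / 2 ∧ 2 * (η + 2 * η * K) ≤ (ε / 4) ^ 2 ∧
      2 * η ≤ (ε / 4) ^ 2 := by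
  have h0 : 0 < (ε / 4) ^ 2 / (2 * (1 + 2 * K)) := by positivity
  refine ⟨min (min (ε / 4) (1 / 2)) ((ε / 4) ^ 2 / (2 * (1 + 2 * K))), ?_, ?_, ?_, ?_, ?_⟩
  · exact lt_min (lt_min (by positivity) (by norm_num)) h0
  · exact (min_le_left _ _).trans (min_le_left _ _)
  · exact (min_le_left _ _).trans (min_le_right _ _)
  all_goals
    have h1 : 0 < min (min (ε / 4) (1 / 2)) ((ε / 4) ^ 2 / (2 * (1 + 2 * K))) :=
      lt_min (lt_min (by positivity) (by norm_num)) h0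
    have h2 := min_le_right (min (ε / 4) (1 / 2)) ((ε / 4) ^ 2 / (2 * (1 + 2 * K)))
    rw [le_div_iff₀ (by positivity)] at h2
    nlinarith

/-- The semidirect product by a sofic action is approximable. -/
theorem IsApproximable.semidirectProduct (hW : 𝒢.AdmitsWreathProducts) (hQ : 𝒢.AdmitsProducts)
    (hT : 𝒢.AdmitsExpansions) {Γ : Type w} [Group Γ] {Δ : Type x} [Group Δ]
    {β : Γ →* MulAut Δ} (hΓ : 𝒢.IsApproximable Γ)
    (hβ : IsSoficAction (fun Λ [Group Λ] => 𝒢.IsApproximable Λ) β) :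
    𝒢.IsApproximable (Δ ⋊[β] Γ) := by
  classical
  -- The weaker of the two separation cases gives `1 / 2 * (1 / 2) * (1 / 12) = 1 / 48`.
  refine ⟨1 / 50, by norm_num, ?_⟩
  intro F ε hε
  obtain ⟨K, hK⟩ : ∃ K : ℝ, 0 ≤ K ∧ ∀ i g h, 𝒢.dist i g h ≤ K := by
    obtain ⟨K, hK⟩ := 𝒢.bounded
    exact ⟨max K 0, le_max_right _ _, fun i g h => (hK i g h).trans (le_max_left _ _)⟩
  obtain ⟨hK0, hK⟩ := hK
  obtain ⟨η, hη, hη1, hη2, hη3, hη4⟩ := exists_small_parameter hε hK0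
  let FΓ : Finset Γ := F.image fun g => g.right
  -- The identity is included to force `π s 1 = 1`, and the twisted elements because the left part
  -- of `g * h` is `g.left * β g.right h.left`.
  let E : Finset Δ := insert 1 (F.image (fun g => g.left) ∪
    (F ×ˢ F).image fun p => β p.1.right p.2.left)
  have hFΓ {g} (hg : g ∈ F) : g.right ∈ FΓ := Finset.mem_image_of_mem _ hg
  have hE1 : (1 : Δ) ∈ E := Finset.mem_insert_self _ _
  have hE {g} (hg : g ∈ F) : g.left ∈ E :=
    Finset.mem_insert_of_mem (Finset.mem_union_left _ (Finset.mem_image_of_mem _ hg))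
  have hEβ {g h} (hg : g ∈ F) (hh : h ∈ F) : β g.right h.left ∈ E :=
    Finset.mem_insert_of_mem (Finset.mem_union_right _ (Finset.mem_image.2
      ⟨(g, h), Finset.mem_product.2 ⟨hg, hh⟩, rfl⟩))
  obtain ⟨Λ, _, A, _, _, φ, hΛ, hφ1, hφ, S, π, hS, hπ, hπβ⟩ := hβ FΓ E η hη
  -- The lower bound on the size of `S` is strict, so it fails for empty `A`.
  have hA : Nonempty A := by
    by_contra hA
    rw [not_nonempty_iff] at hA
    simp [Finset.eq_empty_of_isEmpty S] at hS
  have hAc : (0 : ℝ) < Fintype.card A := by exact_mod_cast Fintype.card_pos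
  -- Amplification is essential here: `Λ` was obtained after `F` and `ε`, so its own constant would
  -- not be uniform.
  obtain ⟨i, ψ, hψ, hψs, hψ1⟩ := hΛ.amplify hQ hT (S.biUnion fun s => E.image (π s)) η hη
  obtain ⟨i', ρ, hρ, hρs, hρ1⟩ := hΓ.amplify hQ hT FΓ η hη
  have hFΛ {s e} (hs : s ∈ S) (he : e ∈ E) : π s e ∈ S.biUnion fun s => E.image (π s) :=
    Finset.mem_biUnion.2 ⟨s, hs, Finset.mem_image_of_mem _ he⟩
  have hπ1 {s} (hs : s ∈ S) : π s 1 = 1 := by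
    have := (hπ s hs).2 1 hE1 1 hE1 (by simpa using hE1)
    rw [mul_one] at this
    exact left_eq_mul.1 this
  obtain ⟨j, D, P, hDP, hD1, hD2, hP⟩ := hW i A
  obtain ⟨k, Q, hQ⟩ := hQ j i'
  -- Outside `S` nothing is known about `π`; the value `1` there keeps `f 1 = 1`.
  let f : Δ → A → 𝒢.G i := fun e a => if a ∈ S then ψ (π a e) else 1
  let X : Δ ⋊[β] Γ → 𝒢.G j := fun g => D (f g.left) * P (φ g.right)
  have hf1 : f 1 = 1 := by
    funext a
    by_cases ha : a ∈ S
    · have h2 : ψ 1 = 1 := hψ1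
      simp [f, ha, hπ1 ha, h2]
    · simp [f, ha]
  have hfS {e s} (hs : s ∈ S) : f e s = ψ (π s e) := if_pos hs
  have hX {g h} (hg : g ∈ F) (hh : h ∈ F) (hgh : g * h ∈ F) :
      𝒢.dist j (X (g * h)) (X g * X h) ≤ ε / 4 + ε / 4 := by
    have e1 : X g * X h = D (f g.left * fun a => f h.left ((φ g.right)⁻¹ a)) *
        P (φ g.right * φ h.right) := by
      simp only [X, map_mul]
      rw [mul_assoc, ← mul_assoc (P (φ g.right)), hDP, mul_assoc, mul_assoc]
    rw [e1]
    refine ((𝒢.isBiinvariantMetric j).mul_mul_le _ _ _ _).trans (add_le_add ?_ ?_)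
    · rw [(𝒢.isBiinvariantMetric j).map_eq]
      refine le_of_sq_le_sq ((hD2 _).trans ?_) (by positivity)
      refine le_trans ?_ hη3
      gcongr
      -- The good points are those of `S` whose preimage under `φ g.right` is also in `S`. There
      -- `e2` is equivariance and `e3` partial multiplicativity, so the multiplicativity of `ψ`
      -- bounds the error by `η`; elsewhere the diameter bound `K` is used.
      refine average_le (S := S ∩ S.map (φ g.right).toEmbedding) hη.le hK0 ?_
        (fun s => hK _ _ _) ?_
      · intro b hb
        obtain ⟨hb, hb2⟩ := Finset.mem_inter.1 hb
        obtain ⟨s, hs, rfl⟩ := Finset.mem_map.1 hb2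
        simp only [Equiv.coe_toEmbedding] at hb ⊢
        have e2 : π (φ g.right s) (β g.right h.left) = π s h.left := by
          have := hπβ g.right (hFΓ hg) (β g.right h.left) (hEβ hg hh) s hs hb
            (by simpa using hE hh)
          simpa using this
        have e3 : π (φ g.right s) (g * h).left =
            π (φ g.right s) g.left * π (φ g.right s) (β g.right h.left) := by
          rw [SemidirectProduct.mul_left]
          exact (hπ _ hb).2 _ (hE hg) _ (hEβ hg hh) (by simpa using hE hgh)
        have e4 := hψ _ (hFΛ hb (hE hg)) _ (hFΛ hb (hEβ hg hh)) (e3 ▸ hFΛ hb (hE hgh))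
        rw [← e3, e2] at e4
        rw [len, Pi.mul_apply, Pi.inv_apply, ← (𝒢.isBiinvariantMetric i).eq_mul_inv,
          Pi.mul_apply, hfS hb, hfS hb,
          show (φ g.right)⁻¹ (φ g.right s) = s from (φ g.right).symm_apply_apply s, hfS hs]
        exact e4.le
      -- Inclusion-exclusion: at most a proportion `2 * η` of the points is bad.
      · have e2 : (S ∩ S.map (φ g.right).toEmbedding).card + Fintype.card A ≥
            S.card + S.card := by
          have h1 := Finset.card_union_add_card_inter S (S.map (φ g.right).toEmbedding)
          rw [Finset.card_map] at h1
          have h2 := Finset.card_le_univ (S ∪ S.map (φ g.right).toEmbedding)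
          omega
        have e3 : (S.card : ℝ) + S.card ≤
            (S ∩ S.map (φ g.right).toEmbedding).card + Fintype.card A := by exact_mod_cast e2
        linarith
    · rw [(𝒢.isBiinvariantMetric j).map_eq]
      refine le_of_sq_le_sq ((hP _).trans ?_) (by positivity)
      rw [← (isBiinvariantMetric_hammingMetric (A := A)).eq_mul_inv]
      have := hφ g.right (hFΓ hg) h.right (hFΓ hh) (by simpa using hFΓ hgh)
      rw [SemidirectProduct.mul_right]
      linarith
  refine ⟨k, fun g => Q (X g, ρ g.right), ?_, ?_, ?_⟩
  · intro g hg h hh hgh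
    dsimp only
    rw [← map_mul, (𝒢.isBiinvariantMetric k).map_eq]
    refine (hQ _).2.trans_lt ?_
    simp only [Prod.mk_mul_mk, Prod.inv_mk, len]
    rw [← (𝒢.isBiinvariantMetric j).eq_mul_inv, ← (𝒢.isBiinvariantMetric i').eq_mul_inv]
    have e1 := hX hg hh hgh
    have e2 := hρ g.right (hFΓ hg) h.right (hFΓ hh) (by simpa using hFΓ hgh)
    rw [SemidirectProduct.mul_right]
    linarith
  · intro g hg hg1
    refine lt_of_lt_of_le ?_ (hQ _).1
    dsimp only
    have n1 := len_nonneg (X g)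
    have n2 := len_nonneg (ρ g.right)
    by_cases hr : g.right = 1
    · have hl : g.left ≠ 1 := fun hl => hg1 (SemidirectProduct.ext hl hr)
      have e1 : X g = D (f g.left) := by
        have h1 : φ 1 = 1 := hφ1
        simp [X, hr, h1]
      have e2 := hD1 (f g.left)
      -- Since `η ≤ 1 / 2`, at least half of the points lie in `S`. At each of them injectivity of
      -- `π s` keeps `g.left` away from `1`, and `ψ` separates by `1 / 12`.
      have e3 : 1 / 2 * (1 / 12) ≤
          (∑ a, 𝒢.len i (f g.left a)) / (Fintype.card A : ℝ) := by
        refine le_average (S := S) (by norm_num) ?_ (fun _ => len_nonneg _) ?_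
        · intro s hs
          rw [hfS hs]
          refine (hψs _ (hFΛ hs (hE hg)) ?_).le
          rw [← hπ1 hs]
          exact fun h => hl ((hπ s hs).1 (hE hg) hE1 h)
        · nlinarith
      rw [e1]
      linarith
    · have := hρs g.right (hFΓ hg) hr
      rw [← len] at this
      linarith
  · have h1 : φ 1 = 1 := hφ1
    have h2 : ρ 1 = 1 := hρ1
    have e1 : X 1 = 1 := by
      simp [X, h1, hf1]
    change Q (X 1, ρ 1) = 1
    rw [e1, h2]
    exact map_one Q

end MetricFamily
end MetricApprox

namespace MetricApprox

/-! ### Symmetric groups with the Hamming metric. -/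

section Sofic

theorem hammingMetric_one {A : Type v} [Fintype A] [DecidableEq A] (σ : Equiv.Perm A) :
    hammingMetric σ 1 = (∑ a, if σ a = a then 0 else 1) / (Fintype.card A : ℝ) := by
  unfold hammingMetric hammingDist
  congr 1
  rw [Finset.card_filter]
  push_cast
  refine Finset.sum_congr rfl fun a _ => ?_
  by_cases h : σ a = a <;> simp [h]

theorem sum_moved {A : Type v} [Fintype A] [DecidableEq A] [Nonempty A] (σ : Equiv.Perm A) :
    (∑ a, if σ a = a then (0 : ℝ) else 1) = Fintype.card A * hammingMetric σ 1 := by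
  rw [hammingMetric_one, mul_div_cancel₀]
  positivity

section Permutations

variable {ι κ : Type*} [Fintype ι] [DecidableEq ι] [Nonempty ι] [Fintype κ] [DecidableEq κ]
  [Nonempty κ]

/-- Functions act fibrewise on `A × ι` and permutations of `A` permute the fibres. Counting moved
points gives both lengths exactly, and lengths at most `1` dominate their squares. -/
theorem containsWreathProduct_perm (A : Type) [Fintype A] [DecidableEq A] [Nonempty A] :
    ContainsWreathProduct (fun σ : Equiv.Perm ι => hammingMetric σ 1) A
      (fun σ : Equiv.Perm (A × ι) => hammingMetric σ 1) := by
  let D : (A → Equiv.Perm ι) →* Equiv.Perm (A × ι) :=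
    { toFun := fun f => Equiv.prodCongrRight f
      map_one' := rfl
      map_mul' := fun _ _ => rfl }
  let P : Equiv.Perm A →* Equiv.Perm (A × ι) :=
    { toFun := fun σ => Equiv.prodCongr σ 1
      map_one' := rfl
      map_mul' := fun _ _ => rfl }
  have hA : (Fintype.card A : ℝ) ≠ 0 := by positivity
  have hn : (Fintype.card ι : ℝ) ≠ 0 := by positivity
  have hD (f : A → Equiv.Perm ι) :
      hammingMetric (D f) 1 = (∑ a, hammingMetric (f a) 1) / Fintype.card A := by
    have h1 (a : A) (x : ι) : D f (a, x) = (a, f a x) := rfl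
    rw [hammingMetric_one, Fintype.sum_prod_type, Fintype.card_prod]
    simp only [h1, Prod.mk.injEq, true_and, sum_moved]
    rw [← Finset.mul_sum]
    push_cast
    field_simp
  have hP (σ : Equiv.Perm A) : hammingMetric (P σ) 1 = hammingMetric σ 1 := by
    have h1 (a : A) (x : ι) : P σ (a, x) = (σ a, x) := rfl
    rw [hammingMetric_one, Fintype.sum_prod_type_right, Fintype.card_prod]
    simp only [h1, Prod.mk.injEq, and_true, sum_moved]
    rw [Finset.sum_const, Finset.card_univ, nsmul_eq_mul]
    push_cast
    field_simp
  have sq_le (σ : Equiv.Perm (A × ι)) : hammingMetric σ 1 ^ 2 ≤ 2 * hammingMetric σ 1 := by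
    have h0 : 0 ≤ hammingMetric σ 1 := isBiinvariantMetric_hammingMetric.nonneg _ _
    have h1 := hammingMetric_le_one σ 1
    nlinarith
  refine ⟨D, P, fun σ f => ?_, fun f => (hD f).ge, fun f => ?_, fun σ => ?_⟩
  · refine Equiv.ext fun ⟨a, x⟩ => ?_
    change (σ a, f a x) = (σ a, f (σ⁻¹ (σ a)) x)
    rw [show σ⁻¹ (σ a) = a from σ.symm_apply_apply a]
  · rw [← hD]
    exact sq_le _
  · rw [← hP]
    exact sq_le _

/-- Each factor acts on its own copy of `ι × κ`. The copies have the same size whatever the sizes of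
`ι` and `κ`, so the length is exactly the mean. -/
theorem containsProduct_perm :
    ContainsProduct (fun σ : Equiv.Perm ι => hammingMetric σ 1)
      (fun σ : Equiv.Perm κ => hammingMetric σ 1)
      (fun σ : Equiv.Perm ((ι × κ) ⊕ (ι × κ)) => hammingMetric σ 1) := by
  let Q : Equiv.Perm ι × Equiv.Perm κ →* Equiv.Perm ((ι × κ) ⊕ (ι × κ)) :=
    { toFun := fun x => Equiv.sumCongr (Equiv.prodCongr x.1 1) (Equiv.prodCongr 1 x.2)
      map_one' := by ext (_ | _) : 1 <;> rfl
      map_mul' := fun _ _ => by ext (_ | _) : 1 <;> rfl }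
  have hn : (Fintype.card ι : ℝ) ≠ 0 := by positivity
  have hn' : (Fintype.card κ : ℝ) ≠ 0 := by positivity
  have hQ (x : Equiv.Perm ι × Equiv.Perm κ) :
      hammingMetric (Q x) 1 = (hammingMetric x.1 1 + hammingMetric x.2 1) / 2 := by
    have h1 (a b) : Q x (Sum.inl (a, b)) = Sum.inl (x.1 a, b) := rfl
    have h2 (a b) : Q x (Sum.inr (a, b)) = Sum.inr (a, x.2 b) := rfl
    rw [hammingMetric_one, Fintype.sum_sum_type, Fintype.sum_prod_type_right,
      Fintype.sum_prod_type, Fintype.card_sum, Fintype.card_prod]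
    simp only [h1, h2, Sum.inl.injEq, Sum.inr.injEq, Prod.mk.injEq, true_and, and_true, sum_moved]
    simp only [Finset.sum_const, Finset.card_univ, nsmul_eq_mul]
    push_cast
    field_simp
    ring
  refine ⟨Q, fun x => ?_⟩
  have h1 : 0 ≤ hammingMetric x.1 1 := isBiinvariantMetric_hammingMetric.nonneg _ _
  have h2 : 0 ≤ hammingMetric x.2 1 := isBiinvariantMetric_hammingMetric.nonneg _ _
  dsimp only
  rw [hQ]
  exact ⟨le_rfl, by linarith⟩

/-- A pair is fixed by the diagonal action iff both entries are, so the length `l` becomes `1 - (1 -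
l) ^ 2`. -/
theorem containsExpansion_perm :
    ContainsExpansion (fun σ : Equiv.Perm ι => hammingMetric σ 1)
      (fun σ : Equiv.Perm (ι × ι) => hammingMetric σ 1) := by
  let t : Equiv.Perm ι →* Equiv.Perm (ι × ι) :=
    { toFun := fun σ => Equiv.prodCongr σ σ
      map_one' := rfl
      map_mul' := fun _ _ => rfl }
  have hn : (Fintype.card ι : ℝ) ≠ 0 := by positivity
  have ht (σ : Equiv.Perm ι) :
      hammingMetric (t σ) 1 = 2 * hammingMetric σ 1 - hammingMetric σ 1 ^ 2 := by
    have h1 (a b) : (if t σ (a, b) = (a, b) then (0 : ℝ) else 1) =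
        (if σ a = a then 0 else 1) + (if σ b = b then 0 else 1) -
          (if σ a = a then 0 else 1) * (if σ b = b then 0 else 1) := by
      have h2 : t σ (a, b) = (σ a, σ b) := rfl
      by_cases ha : σ a = a <;> by_cases hb : σ b = b <;> simp [h2, ha, hb]
    rw [hammingMetric_one, Fintype.sum_prod_type, Fintype.card_prod]
    simp only [h1, Finset.sum_sub_distrib, Finset.sum_add_distrib, ← Finset.mul_sum,
      ← Finset.sum_mul, sum_moved, Finset.sum_const, Finset.card_univ, nsmul_eq_mul]
    push_cast
    field_simp
    ring
  refine ⟨t, fun σ => ?_⟩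
  have h1 : 0 ≤ hammingMetric σ 1 := isBiinvariantMetric_hammingMetric.nonneg _ _
  dsimp only
  rw [ht]
  exact ⟨by nlinarith, fun h => by nlinarith⟩

end Permutations

theorem exists_soficFamily_len_eq (ι : Type) [Fintype ι] [DecidableEq ι] [Nontrivial ι] :
    ∃ (j : soficFamily.Idx) (e : Equiv.Perm ι →* soficFamily.G j),
      ∀ σ, soficFamily.len j (e σ) = hammingMetric σ 1 := by
  have h : Nontrivial (Equiv.Perm (Fin (Fintype.card ι))) := by
    have := Fin.nontrivial_iff_two_le.2 (Fintype.one_lt_card (α := ι))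
    infer_instance
  refine ⟨⟨Fintype.card ι, h⟩, (Fintype.equivFin ι).permCongrHom.toMonoidHom, fun σ => ?_⟩
  change hammingMetric ((Fintype.equivFin ι).permCongr σ) 1 = _
  rw [hammingMetric_one, hammingMetric_one, Fintype.card_fin,
    ← (Fintype.equivFin ι).sum_comp]
  simp [Equiv.permCongr_apply]

theorem nontrivial_of_nontrivial_perm {n : ℕ} (h : Nontrivial (Equiv.Perm (Fin n))) :
    Nontrivial (Fin n) := by
  by_contra hn
  rw [not_nontrivial_iff_subsingleton] at hn
  exact not_subsingleton (Equiv.Perm (Fin n)) inferInstance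

theorem soficFamily_admitsWreathProducts : soficFamily.AdmitsWreathProducts := by
  rintro ⟨n, hn⟩ A _ _ _
  have := nontrivial_of_nontrivial_perm hn
  obtain ⟨j, e, he⟩ := exists_soficFamily_len_eq (A × Fin n)
  have h := (containsWreathProduct_perm (ι := Fin n) A).map e he
  exact ⟨j, h⟩

theorem soficFamily_admitsProducts : soficFamily.AdmitsProducts := by
  rintro ⟨n, hn⟩ ⟨m, hm⟩
  have := nontrivial_of_nontrivial_perm hn
  have := nontrivial_of_nontrivial_perm hm
  have : Nontrivial ((Fin n × Fin m) ⊕ (Fin n × Fin m)) := Sum.inl_injective.nontrivial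
  obtain ⟨j, e, he⟩ := exists_soficFamily_len_eq ((Fin n × Fin m) ⊕ (Fin n × Fin m))
  have h := (containsProduct_perm (ι := Fin n) (κ := Fin m)).map e he
  exact ⟨j, h⟩

theorem soficFamily_admitsExpansions : soficFamily.AdmitsExpansions := by
  rintro ⟨n, hn⟩
  have := nontrivial_of_nontrivial_perm hn
  obtain ⟨j, e, he⟩ := exists_soficFamily_len_eq (Fin n × Fin n)
  have h := (containsExpansion_perm (ι := Fin n)).map e he
  exact ⟨j, h⟩

end Sofic

end MetricApprox

namespace MetricApprox

/-! ### Finite groups with arbitrary bi-invariant metrics of diameter one. -/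

section WeaklySofic

/-- Truncating twice a bi-invariant metric at one. -/
theorem IsBiinvariantMetric.min_one_two_mul {G : Type v} [Group G] {d : G → G → ℝ}
    (hd : IsBiinvariantMetric d) : IsBiinvariantMetric fun g h => min 1 (2 * d g h) where
  self g := by simp [hd.self]
  eq_of_dist_eq_zero {g h} H := by
    refine hd.eq_of_dist_eq_zero ?_
    rcases min_choice 1 (2 * d g h) with h1 | h1 <;> rw [h1] at H <;> linarith
  symm g h := by simp only [hd.symm]
  triangle g h k := by
    have h1 := hd.triangle g h k
    have h2 := hd.nonneg g h
    have h3 := hd.nonneg h k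
    rcases min_choice 1 (2 * d g h) with h4 | h4 <;>
    rcases min_choice 1 (2 * d h k) with h5 | h5 <;> rw [h4, h5]
    · exact (min_le_left _ _).trans (by linarith)
    · exact (min_le_left _ _).trans (by linarith)
    · exact (min_le_left _ _).trans (by linarith)
    · exact (min_le_right _ _).trans (by linarith)
  mul_left a g h := by simp only [hd.mul_left]
  mul_right a g h := by simp only [hd.mul_right]

/-- The average of the metrics of two groups on their product. -/
theorem IsBiinvariantMetric.prod {G : Type v} [Group G] {d : G → G → ℝ} {G' : Type w} [Group G']
    {d' : G' → G' → ℝ} (hd : IsBiinvariantMetric d) (hd' : IsBiinvariantMetric d') :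
    IsBiinvariantMetric fun g h : G × G' => (d g.1 h.1 + d' g.2 h.2) / 2 where
  self g := by simp [hd.self, hd'.self]
  eq_of_dist_eq_zero {g h} H := by
    have h1 := hd.nonneg g.1 h.1
    have h2 := hd'.nonneg g.2 h.2
    exact Prod.ext (hd.eq_of_dist_eq_zero (by linarith)) (hd'.eq_of_dist_eq_zero (by linarith))
  symm g h := by simp only [hd.symm, hd'.symm]
  triangle g h k := by
    have h1 := hd.triangle g.1 h.1 k.1
    have h2 := hd'.triangle g.2 h.2 k.2
    linarith
  mul_left a g h := by simp only [Prod.fst_mul, Prod.snd_mul, hd.mul_left, hd'.mul_left]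
  mul_right a g h := by simp only [Prod.fst_mul, Prod.snd_mul, hd.mul_right, hd'.mul_right]

theorem mulAutArrow_perm_apply {G : Type v} [Group G] {A : Type w} (σ : Equiv.Perm A) (f : A → G)
    (a : A) : mulAutArrow σ f a = f (σ⁻¹ a) := rfl

section Wreath

variable {G : Type v} [Group G] {A : Type w} [Fintype A] [DecidableEq A]

/-- The metric on the permutational wreath product of `G` by `Sym(A)` which averages, over the
points of `A`, the distance of the values where the permutations agree, and one elsewhere. -/
noncomputable def wreathMetric (d : G → G → ℝ) (x y : (A → G) ⋊[mulAutArrow] Equiv.Perm A) : ℝ :=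
  (∑ a, if x.right⁻¹ a = y.right⁻¹ a then d (x.left a) (y.left a) else 1) / Fintype.card A

variable {d : G → G → ℝ}

/-- Inverses are compared because right multiplication by `c` changes the value of `x` at `a` by the
factor `c.left (x.right⁻¹ a)`; this is common to `x` and `y` where the inverses agree, and cancels.
Left multiplication cancels after reindexing by `c.right`. The bound `d ≤ 1` serves the triangle
inequality at points where `x` and `z` agree but `y` does not. -/
theorem IsBiinvariantMetric.wreathMetric [Nonempty A] (hd : IsBiinvariantMetric d)
    (hd1 : ∀ g h, d g h ≤ 1) : IsBiinvariantMetric (wreathMetric (A := A) d) where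
  self x := by simp [MetricApprox.wreathMetric, hd.self]
  eq_of_dist_eq_zero {x y} H := by
    have h0 (a : A) : 0 ≤ if x.right⁻¹ a = y.right⁻¹ a then d (x.left a) (y.left a) else 1 := by
      split_ifs
      · exact hd.nonneg _ _
      · exact zero_le_one
    have hA : (Fintype.card A : ℝ) ≠ 0 := by positivity
    have H := (div_eq_zero_iff.1 H).resolve_right hA
    rw [Finset.sum_eq_zero_iff_of_nonneg fun a _ => h0 a] at H
    have h1 (a : A) : x.right⁻¹ a = y.right⁻¹ a := by
      by_contra h
      have h2 := H a (Finset.mem_univ a)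
      rw [if_neg h] at h2
      exact one_ne_zero h2
    refine SemidirectProduct.ext (funext fun a => hd.eq_of_dist_eq_zero ?_)
      (inv_injective (Equiv.ext h1))
    have h2 := H a (Finset.mem_univ a)
    rwa [if_pos (h1 a)] at h2
  symm x y := by
    simp only [MetricApprox.wreathMetric, hd.symm, eq_comm]
  triangle x y z := by
    unfold MetricApprox.wreathMetric
    rw [← add_div, ← Finset.sum_add_distrib]
    gcongr with a
    have h1 := hd.triangle (x.left a) (y.left a) (z.left a)
    have h2 := hd.nonneg (x.left a) (y.left a)
    have h3 := hd.nonneg (y.left a) (z.left a)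
    have h4 := hd1 (x.left a) (z.left a)
    split_ifs with h5 h6 h7 h7 h6 h7 h7
    all_goals first | linarith | (exfalso; simp_all)
  mul_left c x y := by
    unfold MetricApprox.wreathMetric
    congr 1
    rw [← Equiv.sum_comp c.right]
    refine Finset.sum_congr rfl fun a _ => ?_
    have h1 : c.right⁻¹ (c.right a) = a := c.right.symm_apply_apply a
    simp only [SemidirectProduct.mul_left, SemidirectProduct.mul_right, mul_inv_rev,
      Equiv.Perm.mul_apply, Pi.mul_apply, hd.mul_left, mulAutArrow_perm_apply, h1]
  mul_right c x y := by
    unfold MetricApprox.wreathMetric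
    congr 1
    refine Finset.sum_congr rfl fun a _ => ?_
    simp only [SemidirectProduct.mul_left, SemidirectProduct.mul_right, mul_inv_rev,
      Equiv.Perm.mul_apply, Pi.mul_apply, mulAutArrow_perm_apply, EmbeddingLike.apply_eq_iff_eq]
    refine ite_congr rfl (fun h => ?_) fun _ => rfl
    rw [h, hd.mul_right]

theorem wreathMetric_le_one [Nonempty A] (hd1 : ∀ g h, d g h ≤ 1)
    (x y : (A → G) ⋊[mulAutArrow] Equiv.Perm A) : wreathMetric d x y ≤ 1 := by
  refine div_le_one_of_le₀ ?_ (by positivity)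
  refine (Finset.sum_le_sum (g := fun _ => (1 : ℝ)) fun a _ => ?_).trans (by simp)
  split_ifs
  · exact hd1 _ _
  · exact le_rfl

theorem wreathMetric_inl (f g : A → G) :
    wreathMetric d (SemidirectProduct.inl f) (SemidirectProduct.inl g) =
      (∑ a, d (f a) (g a)) / Fintype.card A := by
  simp [wreathMetric]

theorem wreathMetric_inr (hd : IsBiinvariantMetric d) (σ : Equiv.Perm A) :
    wreathMetric d (SemidirectProduct.inr σ) 1 = hammingMetric σ 1 := by
  rw [hammingMetric_one]
  unfold wreathMetric
  congr 1
  refine Finset.sum_congr rfl fun a _ => ?_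
  have h : σ⁻¹ a = a ↔ σ a = a := by rw [Equiv.Perm.inv_eq_iff_eq, eq_comm]
  simp only [SemidirectProduct.right_inr, SemidirectProduct.left_inr, SemidirectProduct.one_right,
    SemidirectProduct.one_left, hd.self, inv_one, Equiv.Perm.one_apply, h]

theorem containsWreathProduct_wreathMetric {A : Type} [Fintype A] [DecidableEq A] [Nonempty A]
    (hd : IsBiinvariantMetric d) (hd1 : ∀ g h, d g h ≤ 1) :
    ContainsWreathProduct (fun g => d g 1) A
      (fun x : (A → G) ⋊[mulAutArrow] Equiv.Perm A => wreathMetric d x 1) := by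
  have hD (f : A → G) : wreathMetric d (SemidirectProduct.inl f) 1 =
      (∑ a, d (f a) 1) / Fintype.card A := by
    have h := wreathMetric_inl (d := d) f 1
    rwa [map_one] at h
  have sq_le (x : (A → G) ⋊[mulAutArrow] Equiv.Perm A) :
      wreathMetric d x 1 ^ 2 ≤ 2 * wreathMetric d x 1 := by
    have h0 := (hd.wreathMetric hd1).nonneg x 1
    have h1 := wreathMetric_le_one hd1 x 1
    nlinarith
  refine ⟨SemidirectProduct.inl, SemidirectProduct.inr, fun σ f => ?_, fun f => (hD f).ge,
    fun f => (sq_le _).trans (by rw [hD]), fun σ => (sq_le _).trans (by rw [wreathMetric_inr hd])⟩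
  have h := SemidirectProduct.inl_aut (φ := mulAutArrow) σ f
  change _ = SemidirectProduct.inl (mulAutArrow σ f) * SemidirectProduct.inr σ
  rw [h, mul_assoc, ← map_mul, inv_mul_cancel, map_one, mul_one]

end Wreath

theorem containsProduct_prod {G : Type v} [Group G] {d : G → G → ℝ} {G' : Type w} [Group G']
    {d' : G' → G' → ℝ} (hd : IsBiinvariantMetric d) (hd' : IsBiinvariantMetric d') :
    ContainsProduct (fun g => d g 1) (fun g => d' g 1)
      (fun x : G × G' => (d x.1 1 + d' x.2 1) / 2) := by
  refine ⟨MonoidHom.id _, fun x => ⟨le_rfl, ?_⟩⟩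
  have h1 := hd.nonneg x.1 1
  have h2 := hd'.nonneg x.2 1
  change (d x.1 1 + d' x.2 1) / 2 ≤ _
  linarith

/-- The family allows any metric, so expansion is a change of metric along the identity
homomorphism. -/
theorem containsExpansion_min {G : Type v} [Group G] {d : G → G → ℝ}
    (hd : IsBiinvariantMetric d) :
    ContainsExpansion (fun g => d g 1) (fun g => min 1 (2 * d g 1)) := by
  refine ⟨MonoidHom.id _, fun x => ⟨min_le_right _ _, fun h => ?_⟩⟩
  have h1 := hd.nonneg x 1
  change 5 / 4 * d x 1 ≤ min 1 (2 * d x 1)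
  exact le_min (by linarith) (by linarith)

theorem exists_weaklySoficFamily_len_eq {H : Type} [Group H] [Finite H] {d : H → H → ℝ}
    (hd : IsBiinvariantMetric d) (hd1 : ∀ g h, d g h ≤ 1) (hd2 : ∃ g h, d g h = 1) :
    ∃ (j : weaklySoficFamily.Idx) (e : H →* weaklySoficFamily.G j),
      ∀ x, weaklySoficFamily.len j (e x) = d x 1 :=
  ⟨⟨H, d, hd, hd1, hd2⟩, MonoidHom.id H, fun _ => rfl⟩

theorem weaklySoficFamily_admitsWreathProducts : weaklySoficFamily.AdmitsWreathProducts := by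
  rintro ⟨G, d, hd, hd1, hd2⟩ A _ _ _
  have : Finite ((A → G) ⋊[mulAutArrow] Equiv.Perm A) :=
    Finite.of_equiv _ SemidirectProduct.equivProd.symm
  have hA : (Fintype.card A : ℝ) ≠ 0 := by positivity
  obtain ⟨j, e, he⟩ := exists_weaklySoficFamily_len_eq (hd.wreathMetric (A := A) hd1)
    (wreathMetric_le_one hd1) <| by
      obtain ⟨g, h, hgh⟩ := hd2
      refine ⟨SemidirectProduct.inl fun _ => g, SemidirectProduct.inl fun _ => h, ?_⟩
      rw [wreathMetric_inl]
      simp [hgh]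
  have h := (containsWreathProduct_wreathMetric (A := A) hd hd1).map e he
  exact ⟨j, h⟩

theorem weaklySoficFamily_admitsProducts : weaklySoficFamily.AdmitsProducts := by
  rintro ⟨G, d, hd, hd1, hd2⟩ ⟨G', d', hd', hd1', hd2'⟩
  obtain ⟨j, e, he⟩ := exists_weaklySoficFamily_len_eq (hd.prod hd')
    (fun g h => by linarith [hd1 g.1 h.1, hd1' g.2 h.2]) <| by
      obtain ⟨g, h, hgh⟩ := hd2
      obtain ⟨g', h', hgh'⟩ := hd2'
      exact ⟨(g, g'), (h, h'), by simp only [hgh, hgh']; norm_num⟩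
  have h := (containsProduct_prod hd hd').map e he
  exact ⟨j, h⟩

theorem weaklySoficFamily_admitsExpansions : weaklySoficFamily.AdmitsExpansions := by
  rintro ⟨G, d, hd, hd1, hd2⟩
  obtain ⟨j, e, he⟩ := exists_weaklySoficFamily_len_eq hd.min_one_two_mul
    (fun g h => min_le_left _ _) <| by
      obtain ⟨g, h, hgh⟩ := hd2
      exact ⟨g, h, by rw [hgh]; norm_num⟩
  have h := (containsExpansion_min hd).map e he
  exact ⟨j, h⟩

end WeaklySofic

end MetricApprox

namespace MetricApprox

/-! ### Homomorphisms into matrix algebras, shared by the linear sofic and hyperlinear cases. -/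

section MatrixHoms

open scoped Kronecker

variable (ι κ A : Type*) [Fintype ι] [DecidableEq ι] [Fintype κ] [DecidableEq κ] [Fintype A]
  [DecidableEq A] (R : Type*) [CommRing R]

/-- The Kronecker product as a homomorphism. -/
def kroneckerHom : Matrix ι ι R × Matrix κ κ R →* Matrix (ι × κ) (ι × κ) R where
  toFun x := x.1 ⊗ₖ x.2
  map_one' := Matrix.one_kronecker_one
  map_mul' _ _ := Matrix.mul_kronecker_mul _ _ _ _

/-- The sum of two square matrices, of sizes made equal by repeating blocks. -/
def balancedSumHom : Matrix ι ι R × Matrix κ κ R →* Matrix ((ι × κ) × Bool) ((ι × κ) × Bool) R where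
  toFun x := Matrix.blockDiagonal fun b => bif b then x.1 ⊗ₖ 1 else 1 ⊗ₖ x.2
  map_one' := by
    rw [← Matrix.blockDiagonal_one]
    congr 1
    ext1 b
    cases b <;> simp
  map_mul' x y := by
    rw [← Matrix.blockDiagonal_mul]
    congr 1
    ext1 b
    cases b <;> simp [← Matrix.mul_kronecker_mul]

/-- The permutation matrices which permute equal blocks. -/
def blockPermHom : Equiv.Perm A →* Matrix (ι × A) (ι × A) R :=
  Matrix.permMatrixHom.comp
    { toFun := fun σ => Equiv.prodCongr 1 σ
      map_one' := rfl
      map_mul' := fun _ _ => rfl }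

variable {ι A R}

/-- The inverse appears because `PEquiv.toMatrix` turns composition in diagrammatic order into
products. -/
theorem blockPermHom_eq (σ : Equiv.Perm A) :
    blockPermHom ι A R σ = (Equiv.prodCongr (1 : Equiv.Perm ι) σ⁻¹).toPEquiv.toMatrix := rfl

theorem blockPermHom_mul_blockDiagonal (σ : Equiv.Perm A) (f : A → Matrix ι ι R) :
    blockPermHom ι A R σ * Matrix.blockDiagonal f =
      Matrix.blockDiagonal (fun a => f (σ⁻¹ a)) * blockPermHom ι A R σ := by
  rw [blockPermHom_eq, PEquiv.toMatrix_toPEquiv_mul, PEquiv.mul_toMatrix_toPEquiv]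
  ext ⟨x, a⟩ ⟨y, b⟩
  have h : σ⁻¹ a = b ↔ a = σ b := Equiv.Perm.inv_eq_iff_eq
  change Matrix.blockDiagonal f (x, σ⁻¹ a) (y, b) =
    Matrix.blockDiagonal (fun a => f (σ⁻¹ a)) (x, a) (y, σ b)
  simp only [Matrix.blockDiagonal_apply, h]

end MatrixHoms

/-! ### Rank identities and inequalities over a field. -/

section Rank

open scoped Kronecker

variable {ι κ A : Type*} [Fintype ι] [DecidableEq ι] [Fintype κ] [DecidableEq κ] [Fintype A]
  [DecidableEq A] {K : Type*} [Field K]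

theorem exists_eq_mul_diagonal_mul (M : Matrix ι ι K) :
    ∃ (V U : Matrix ι ι K) (w : ι → K), IsUnit V.det ∧ IsUnit U.det ∧
      M = V * Matrix.diagonal w * U := by
  obtain ⟨L, L', D, h⟩ := Matrix.Pivot.exists_list_transvec_mul_diagonal_mul_list_transvec M
  exact ⟨_, _, D, by simp, by simp, h⟩

theorem rank_mul_diagonal_mul [DecidableEq K] {V U : Matrix ι ι K} (hV : IsUnit V.det)
    (hU : IsUnit U.det) (w : ι → K) :
    (V * Matrix.diagonal w * U).rank = Fintype.card {i // w i ≠ 0} := by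
  rw [Matrix.rank_mul_eq_left_of_isUnit_det _ _ hU, Matrix.rank_mul_eq_right_of_isUnit_det _ _ hV,
    Matrix.rank_diagonal]

theorem isUnit_det_kronecker {V : Matrix ι ι K} {U : Matrix κ κ K} (hV : IsUnit V.det)
    (hU : IsUnit U.det) : IsUnit (V ⊗ₖ U).det := by
  rw [Matrix.det_kronecker]
  exact (hV.pow _).mul (hU.pow _)

/-- Reducing both factors to diagonal form by invertible matrices leaves a count of nonzero products
of diagonal entries. -/
theorem rank_kronecker (M : Matrix ι ι K) (N : Matrix κ κ K) :
    (M ⊗ₖ N).rank = M.rank * N.rank := by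
  classical
  obtain ⟨V, U, w, hV, hU, rfl⟩ := exists_eq_mul_diagonal_mul M
  obtain ⟨V', U', w', hV', hU', rfl⟩ := exists_eq_mul_diagonal_mul N
  rw [Matrix.mul_kronecker_mul, Matrix.mul_kronecker_mul, Matrix.diagonal_kronecker_diagonal,
    rank_mul_diagonal_mul (isUnit_det_kronecker hV hV') (isUnit_det_kronecker hU hU'),
    rank_mul_diagonal_mul hV hU, rank_mul_diagonal_mul hV' hU', ← Fintype.card_prod]
  refine Fintype.card_congr ((Equiv.subtypeEquivRight fun x => mul_ne_zero_iff).trans ?_)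
  exact Equiv.subtypeProdEquivProd (p := fun i => w i ≠ 0) (q := fun i => w' i ≠ 0)

theorem rank_blockDiagonal (M : A → Matrix ι ι K) :
    (Matrix.blockDiagonal M).rank = ∑ a, (M a).rank := by
  classical
  choose V U w hV hU hM using fun a => exists_eq_mul_diagonal_mul (M a)
  have h1 : Matrix.blockDiagonal M = Matrix.blockDiagonal V *
      Matrix.diagonal (fun x : ι × A => w x.2 x.1) * Matrix.blockDiagonal U := by
    rw [← Matrix.blockDiagonal_diagonal, ← Matrix.blockDiagonal_mul, ← Matrix.blockDiagonal_mul]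
    exact congrArg _ (funext hM)
  have h2 {V : A → Matrix ι ι K} (hV : ∀ a, IsUnit (V a).det) :
      IsUnit (Matrix.blockDiagonal V).det := by
    rw [Matrix.det_blockDiagonal, isUnit_iff_ne_zero, Finset.prod_ne_zero_iff]
    exact fun a _ => (hV a).ne_zero
  have h3 (a : A) : (M a).rank = Fintype.card {i // w a i ≠ 0} := by
    conv_lhs => rw [hM a]
    exact rank_mul_diagonal_mul (hV a) (hU a) _
  simp only [h3]
  rw [h1, rank_mul_diagonal_mul (h2 hV) (h2 hU), ← Fintype.card_sigma]
  exact Fintype.card_congr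
    { toFun := fun x => ⟨x.1.2, x.1.1, x.2⟩
      invFun := fun x => ⟨(x.2.1, x.1), x.2.2⟩
      left_inv := fun _ => rfl
      right_inv := fun _ => rfl }

theorem rank_matrix_add_le {n : Type*} [Fintype n] (M N : Matrix n n K) :
    (M + N).rank ≤ M.rank + N.rank := by
  unfold Matrix.rank
  rw [Matrix.mulVecLin_add]
  refine (Submodule.finrank_mono ?_).trans (Submodule.finrank_add_le_finrank_add_finrank _ _)
  exact LinearMap.range_add_le _ _

/-- Rank-nullity on a subspace. -/
theorem finrank_map_add_finrank_inf_ker {V W : Type*} [AddCommGroup V] [Module K V]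
    [AddCommGroup W] [Module K W] [FiniteDimensional K V] (T : V →ₗ[K] W) (S : Submodule K V) :
    Module.finrank K (S.map T) + Module.finrank K (S ⊓ LinearMap.ker T : Submodule K V) =
      Module.finrank K S := by
  rw [← LinearMap.finrank_range_add_finrank_ker (T.domRestrict S), LinearMap.range_domRestrict,
    LinearMap.ker_domRestrict]
  congr 1
  rw [← Submodule.map_comap_subtype]
  exact LinearEquiv.finrank_eq
    (Submodule.equivMapOfInjective S.subtype S.injective_subtype _).symm

/-- The Frobenius rank inequality. -/
theorem rank_mul_add_rank_mul_le {n : Type*} [Fintype n] (T L C : Matrix n n K) :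
    (T * L).rank + (L * C).rank ≤ L.rank + (T * L * C).rank := by
  have h1 := finrank_map_add_finrank_inf_ker T.mulVecLin (LinearMap.range L.mulVecLin)
  have h2 := finrank_map_add_finrank_inf_ker T.mulVecLin (LinearMap.range (L * C).mulVecLin)
  rw [← LinearMap.range_comp, ← Matrix.mulVecLin_mul] at h1 h2
  have h3 : LinearMap.range (L * C).mulVecLin ≤ LinearMap.range L.mulVecLin := by
    rw [Matrix.mulVecLin_mul]
    exact LinearMap.range_comp_le_range _ _
  -- Applying `T` loses no more dimension on the range of `L * C` than on the larger range of `L`.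
  have h4 := Submodule.finrank_mono (inf_le_inf_right (LinearMap.ker T.mulVecLin) h3)
  rw [mul_assoc]
  unfold Matrix.rank
  omega

/-- Once `N` is diagonalised, the projection onto the zero diagonal entries annihilates it from both
sides. -/
theorem exists_annihilators (N : Matrix ι ι K) :
    ∃ T Q : Matrix ι ι K, T * N = 0 ∧ N * Q = 0 ∧ T.rank + N.rank = Fintype.card ι ∧
      Q.rank + N.rank = Fintype.card ι := by
  classical
  obtain ⟨V, U, w, hV, hU, rfl⟩ := exists_eq_mul_diagonal_mul N
  let w' : ι → K := fun i => if w i = 0 then 1 else 0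
  have h1 : Matrix.diagonal w' * Matrix.diagonal w = 0 := by
    rw [Matrix.diagonal_mul_diagonal, Matrix.diagonal_eq_zero]
    funext i
    by_cases h : w i = 0 <;> simp [w', h]
  have h2 : Matrix.diagonal w * Matrix.diagonal w' = 0 := by
    rw [Matrix.diagonal_mul_diagonal, Matrix.diagonal_eq_zero]
    funext i
    by_cases h : w i = 0 <;> simp [w', h]
  have h3 : (Matrix.diagonal w').rank + Fintype.card {i // w i ≠ 0} = Fintype.card ι := by
    have h4 : Fintype.card {i // w' i ≠ 0} = Fintype.card {i // ¬ w i ≠ 0} :=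
      Fintype.card_congr (Equiv.subtypeEquivRight fun i => by by_cases h : w i = 0 <;> simp [w', h])
    rw [Matrix.rank_diagonal, h4, Fintype.card_subtype_compl,
      Nat.sub_add_cancel (Fintype.card_subtype_le _)]
  refine ⟨Matrix.diagonal w' * V⁻¹, U⁻¹ * Matrix.diagonal w', ?_, ?_, ?_, ?_⟩
  · rw [mul_assoc, mul_assoc V, Matrix.nonsing_inv_mul_cancel_left _ _ hV, ← mul_assoc, h1,
      zero_mul]
  · rw [mul_assoc, Matrix.mul_nonsing_inv_cancel_left _ _ hU, mul_assoc, h2, mul_zero]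
  · rw [rank_mul_diagonal_mul hV hU, Matrix.rank_mul_eq_left_of_isUnit_det, h3]
    exact Matrix.isUnit_nonsing_inv_det _ hV
  · rw [rank_mul_diagonal_mul hV hU, Matrix.rank_mul_eq_right_of_isUnit_det, h3]
    exact Matrix.isUnit_nonsing_inv_det _ hU

/-- Eigenvalues are not available over `K`, so the Frobenius inequality is used instead. Let `n` be
the size, `r` the rank of `M - 1`, `L = M ⊗ₖ M - 1`, and `T`, `Q` the left and right annihilators of
`M - 1`. Then `L * (1 ⊗ₖ Q) = (M - 1) ⊗ₖ Q` has rank `r * (n - r)` and is killed by `T ⊗ₖ 1`. Also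
`(T ⊗ₖ 1) * L` has rank at least that of `(T * Q) ⊗ₖ (M - 1)`, hence at least `(n - 2 * r) * r`. The
two ranks add up to a lower bound for the rank of `L`. -/
theorem le_rank_kronecker_self_sub_one (M : Matrix ι ι K) :
    2 * Fintype.card ι * (M - 1).rank ≤ (M ⊗ₖ M - 1).rank + 3 * (M - 1).rank ^ 2 := by
  obtain ⟨T, Q, hT, hQ, hTr, hQr⟩ := exists_annihilators (M - 1)
  have hMQ : M * Q = Q := by
    rw [sub_mul, one_mul, sub_eq_zero] at hQ
    exact hQ
  have h1 : (M ⊗ₖ M - 1) * ((1 : Matrix ι ι K) ⊗ₖ Q) = (M - 1) ⊗ₖ Q := by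
    rw [sub_mul, one_mul, ← Matrix.mul_kronecker_mul, hMQ, mul_one, sub_eq_iff_eq_add,
      ← Matrix.add_kronecker, sub_add_cancel]
  have h2 : (M ⊗ₖ M - 1) * (Q ⊗ₖ (1 : Matrix ι ι K)) = Q ⊗ₖ (M - 1) := by
    rw [sub_mul, one_mul, ← Matrix.mul_kronecker_mul, hMQ, mul_one, sub_eq_iff_eq_add,
      ← Matrix.kronecker_add, sub_add_cancel]
  have h3 := rank_mul_add_rank_mul_le (T ⊗ₖ (1 : Matrix ι ι K)) (M ⊗ₖ M - 1)
    ((1 : Matrix ι ι K) ⊗ₖ Q)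
  rw [mul_assoc, h1, ← Matrix.mul_kronecker_mul, hT, Matrix.zero_kronecker, Matrix.rank_zero,
    rank_kronecker] at h3
  have h4 := Matrix.rank_mul_le_left ((T ⊗ₖ (1 : Matrix ι ι K)) * (M ⊗ₖ M - 1))
    (Q ⊗ₖ (1 : Matrix ι ι K))
  rw [mul_assoc, h2, ← Matrix.mul_kronecker_mul, rank_kronecker, one_mul] at h4
  have h5 := rank_mul_add_rank_mul_le T 1 Q
  rw [mul_one, one_mul, Matrix.rank_one] at h5
  nlinarith

theorem rank_kronecker_self_sub_one_le (M : Matrix ι ι K) :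
    (M ⊗ₖ M - 1).rank ≤ 2 * Fintype.card ι * (M - 1).rank := by
  have h1 : M ⊗ₖ M - 1 = (M - 1) ⊗ₖ M + 1 ⊗ₖ (M - 1) := by
    rw [sub_eq_iff_eq_add, ← Matrix.one_kronecker_one, add_assoc, ← Matrix.kronecker_add,
      sub_add_cancel, ← Matrix.add_kronecker, sub_add_cancel]
  rw [h1]
  refine (rank_matrix_add_le _ _).trans ?_
  rw [rank_kronecker, rank_kronecker, Matrix.rank_one]
  have := M.rank_le_card_height
  nlinarith

/-- Only the rows over points moved by `σ` are nonzero. -/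
theorem rank_blockPermHom_sub_one_le (σ : Equiv.Perm A) :
    (blockPermHom ι A K σ - 1).rank ≤
      Fintype.card ι * (Finset.univ.filter fun a => σ a ≠ a).card := by
  refine (Matrix.rank_le_card_of_support_subset _
    (Finset.univ ×ˢ Finset.univ.filter fun a => σ a ≠ a) ?_).trans (by
      rw [Finset.card_product, Finset.card_univ])
  rintro ⟨x, a⟩ h
  simp only [Finset.coe_product, Finset.coe_univ, Set.mem_prod, Set.mem_univ, true_and,
    Finset.coe_filter, Finset.mem_univ, Set.mem_ofPred_eq]
  intro ha
  refine h (funext fun y => ?_)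
  have h1 : σ⁻¹ a = a := by rw [Equiv.Perm.inv_eq_iff_eq, ha]
  have h2 : blockPermHom ι A K σ = (1 : Matrix (ι × A) (ι × A) K).submatrix
      (Equiv.prodCongr (1 : Equiv.Perm ι) σ⁻¹) id := by
    rw [blockPermHom_eq, ← PEquiv.toMatrix_toPEquiv_mul, mul_one]
  change (blockPermHom ι A K σ - 1) (x, a) y = 0
  rw [h2, Matrix.sub_apply]
  change (1 : Matrix (ι × A) (ι × A) K) (x, σ⁻¹ a) y - (1 : Matrix (ι × A) (ι × A) K) (x, a) y = 0
  rw [h1, sub_self]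

end Rank

/-! ### General linear groups with the rank metric. -/

section LinearSofic

open scoped Kronecker

variable {ι κ : Type*} [Fintype ι] [DecidableEq ι] [Fintype κ] [DecidableEq κ]
  {K : Type u} [Field K]

/-- The normalized rank length on `GL_ι(K)`. -/
noncomputable def rankLen (M : GL ι K) : ℝ :=
  ((M.1 - 1).rank : ℝ) / Fintype.card ι

theorem rankLen_nonneg (M : GL ι K) : 0 ≤ rankLen M := by
  unfold rankLen
  positivity

theorem rankLen_le_one (M : GL ι K) : rankLen M ≤ 1 := by
  unfold rankLen
  refine div_le_one_of_le₀ ?_ (by positivity)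
  exact_mod_cast Matrix.rank_le_card_height _

theorem containsWreathProduct_rankLen [Nonempty ι] (A : Type) [Fintype A] [DecidableEq A]
    [Nonempty A] :
    ContainsWreathProduct (rankLen : GL ι K → ℝ) A (rankLen : GL (ι × A) K → ℝ) := by
  let D : (A → GL ι K) →* GL (ι × A) K :=
    (Units.map (Matrix.blockDiagonalRingHom ι A K).toMonoidHom).comp
      MulEquiv.piUnits.symm.toMonoidHom
  let P : Equiv.Perm A →* GL (ι × A) K := (blockPermHom ι A K).toHomUnits
  have hA : (Fintype.card A : ℝ) ≠ 0 := by positivity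
  have hn : (Fintype.card ι : ℝ) ≠ 0 := by positivity
  have hD1 (f : A → GL ι K) : (D f).1 = Matrix.blockDiagonal fun a => (f a).1 := rfl
  have hD (f : A → GL ι K) : rankLen (D f) = (∑ a, rankLen (f a)) / Fintype.card A := by
    unfold rankLen
    rw [hD1, ← Matrix.blockDiagonal_one, ← Matrix.blockDiagonal_sub, rank_blockDiagonal,
      ← Finset.sum_div, Fintype.card_prod]
    push_cast
    rw [div_div]
    rfl
  have hP (σ : Equiv.Perm A) : rankLen (P σ) ≤ hammingMetric σ 1 := by
    have h := rank_blockPermHom_sub_one_le (ι := ι) (K := K) σ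
    have h2 : hammingMetric σ 1 = ((Finset.univ.filter fun a => σ a ≠ a).card : ℝ) /
      Fintype.card A := rfl
    have h3 : ((blockPermHom ι A K σ - 1).rank : ℝ) ≤
        Fintype.card ι * (Finset.univ.filter fun a => σ a ≠ a).card := by exact_mod_cast h
    change ((blockPermHom ι A K σ - 1).rank : ℝ) / Fintype.card (ι × A) ≤ _
    rw [h2, Fintype.card_prod, div_le_div_iff₀ (by positivity) (by positivity)]
    push_cast
    nlinarith [Fintype.card_pos (α := A)]
  have sq_le (M : GL (ι × A) K) : rankLen M ^ 2 ≤ 2 * rankLen M := by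
    nlinarith [rankLen_nonneg M, rankLen_le_one M]
  refine ⟨D, P, fun σ f => Units.ext ?_, fun f => (hD f).ge, fun f => ?_, fun σ => ?_⟩
  · exact blockPermHom_mul_blockDiagonal σ _
  · rw [← hD]
    exact sq_le _
  · exact (sq_le _).trans (by linarith [hP σ])

theorem containsProduct_rankLen [Nonempty ι] [Nonempty κ] :
    ContainsProduct (rankLen : GL ι K → ℝ) (rankLen : GL κ K → ℝ)
      (rankLen : GL ((ι × κ) × Bool) K → ℝ) := by
  let Q : GL ι K × GL κ K →* GL ((ι × κ) × Bool) K :=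
    (Units.map (balancedSumHom ι κ K)).comp MulEquiv.prodUnits.symm.toMonoidHom
  have hn : (Fintype.card ι : ℝ) ≠ 0 := by positivity
  have hm : (Fintype.card κ : ℝ) ≠ 0 := by positivity
  have hQ1 (x : GL ι K × GL κ K) : (Q x).1 =
      Matrix.blockDiagonal fun b => bif b then x.1.1 ⊗ₖ 1 else 1 ⊗ₖ x.2.1 := rfl
  have hQ (x : GL ι K × GL κ K) : rankLen (Q x) = (rankLen x.1 + rankLen x.2) / 2 := by
    have h1 : x.1.1 ⊗ₖ (1 : Matrix κ κ K) - 1 = (x.1.1 - 1) ⊗ₖ 1 := by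
      rw [sub_eq_iff_eq_add, ← Matrix.one_kronecker_one, ← Matrix.add_kronecker, sub_add_cancel]
    have h2 : (1 : Matrix ι ι K) ⊗ₖ x.2.1 - 1 = 1 ⊗ₖ (x.2.1 - 1) := by
      rw [sub_eq_iff_eq_add, ← Matrix.one_kronecker_one, ← Matrix.kronecker_add, sub_add_cancel]
    unfold rankLen
    rw [hQ1, ← Matrix.blockDiagonal_one, ← Matrix.blockDiagonal_sub, rank_blockDiagonal,
      Fintype.sum_bool]
    simp only [Pi.sub_apply, Pi.one_apply, cond_true, cond_false, h1, h2, rank_kronecker,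
      Matrix.rank_one, Fintype.card_prod, Fintype.card_bool]
    push_cast
    field_simp
  refine ⟨Q, fun x => ?_⟩
  rw [hQ]
  exact ⟨le_rfl, by linarith [rankLen_nonneg x.1, rankLen_nonneg x.2]⟩

theorem containsExpansion_rankLen [Nonempty ι] :
    ContainsExpansion (rankLen : GL ι K → ℝ) (rankLen : GL (ι × ι) K → ℝ) := by
  let t : GL ι K →* GL (ι × ι) K :=
    Units.map ((kroneckerHom ι ι K).comp ((MonoidHom.id _).prod (MonoidHom.id _)))
  have hn : (0 : ℝ) < Fintype.card ι := by positivity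
  have hlen (M : GL ι K) : ((M.1 - 1).rank : ℝ) = Fintype.card ι * rankLen M := by
    unfold rankLen
    field_simp
  have ht (M : GL ι K) : ((M.1 ⊗ₖ M.1 - 1).rank : ℝ) =
      Fintype.card ι * Fintype.card ι * rankLen (t M) := by
    have h : (t M).1 = M.1 ⊗ₖ M.1 := rfl
    unfold rankLen
    rw [h, Fintype.card_prod]
    push_cast
    field_simp
  have hn2 : (0 : ℝ) < Fintype.card ι * Fintype.card ι := by positivity
  refine ⟨t, fun M => ⟨?_, fun h => ?_⟩⟩
  · have h1 : ((M.1 ⊗ₖ M.1 - 1).rank : ℝ) ≤ 2 * Fintype.card ι * (M.1 - 1).rank := by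
      exact_mod_cast rank_kronecker_self_sub_one_le M.1
    rw [hlen, ht] at h1
    refine le_of_mul_le_mul_left ?_ hn2
    linarith
  · have h1 : 2 * Fintype.card ι * ((M.1 - 1).rank : ℝ) ≤
        (M.1 ⊗ₖ M.1 - 1).rank + 3 * ((M.1 - 1).rank : ℝ) ^ 2 := by
      exact_mod_cast le_rank_kronecker_self_sub_one M.1
    rw [hlen, ht] at h1
    have h2 : 2 * rankLen M ≤ rankLen (t M) + 3 * rankLen M ^ 2 := by
      refine le_of_mul_le_mul_left ?_ hn2
      linarith
    -- For `l ≤ 1 / 6` the bound `2 * l - 3 * l ^ 2` is at least `3 / 2 * l`.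
    nlinarith [rankLen_nonneg M]

/-- Nonempty index types do not suffice, as `GL₁` of the field with two elements is trivial.
Nontriviality is carried along the embedding by repeated diagonal blocks. -/
theorem nontrivial_GL_prod (A : Type*) [Fintype A] [DecidableEq A] [Nonempty A]
    [Nontrivial (GL ι K)] : Nontrivial (GL (ι × A) K) := by
  refine Function.Injective.nontrivial (α := GL ι K)
    (f := Units.map ((Matrix.blockDiagonalRingHom ι A K).toMonoidHom.comp
      (Pi.constRingHom A (Matrix ι ι K)).toMonoidHom)) (Units.map_injective ?_)
  exact Matrix.blockDiagonal_injective.comp Function.const_injective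

theorem nonempty_of_nontrivial_GL [Nontrivial (GL ι K)] : Nonempty ι := by
  by_contra h
  rw [not_nonempty_iff] at h
  exact not_subsingleton (GL ι K) inferInstance

theorem exists_linearSoficFamily_len_eq (ι : Type) [Fintype ι] [DecidableEq ι]
    [Nontrivial (GL ι K)] :
    ∃ (j : (linearSoficFamily K).Idx) (e : GL ι K →* (linearSoficFamily K).G j),
      ∀ M, (linearSoficFamily K).len j (e M) = rankLen M := by
  let e : GL ι K ≃* GL (Fin (Fintype.card ι)) K :=
    Units.mapEquiv (Matrix.reindexAlgEquiv K K (Fintype.equivFin ι)).toMulEquiv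
  refine ⟨⟨Fintype.card ι, e.symm.toEquiv.nontrivial⟩, e.toMonoidHom, fun M => ?_⟩
  change ((Matrix.reindexAlgEquiv K K (Fintype.equivFin ι) M.1 - 1).rank : ℝ) / _ = _
  rw [← map_one (Matrix.reindexAlgEquiv K K (Fintype.equivFin ι)), ← map_sub,
    Matrix.coe_reindexAlgEquiv, Matrix.rank_reindex]
  rfl

theorem linearSoficFamily_len_mk {n : ℕ} (hn : Nontrivial (GL (Fin n) K)) :
    (linearSoficFamily K).len ⟨n, hn⟩ = (rankLen : GL (Fin n) K → ℝ) := by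
  funext M
  change (_ : ℝ) / (n : ℝ) = _ / (Fintype.card (Fin n) : ℝ)
  rw [Fintype.card_fin]
  rfl

theorem linearSoficFamily_admitsWreathProducts :
    (linearSoficFamily K).AdmitsWreathProducts := by
  rintro ⟨n, hn⟩ A _ _ _
  have := nonempty_of_nontrivial_GL (ι := Fin n) (K := K)
  have := nontrivial_GL_prod (ι := Fin n) (K := K) A
  obtain ⟨j, e, he⟩ := exists_linearSoficFamily_len_eq (K := K) (Fin n × A)
  have h := (containsWreathProduct_rankLen (ι := Fin n) (K := K) A).map e he
  rw [linearSoficFamily_len_mk]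
  exact ⟨j, h⟩

theorem linearSoficFamily_admitsProducts : (linearSoficFamily K).AdmitsProducts := by
  rintro ⟨n, hn⟩ ⟨m, hm⟩
  have := nonempty_of_nontrivial_GL (ι := Fin n) (K := K)
  have := nonempty_of_nontrivial_GL (ι := Fin m) (K := K)
  have := nontrivial_GL_prod (ι := Fin n) (K := K) (Fin m)
  have := nontrivial_GL_prod (ι := Fin n × Fin m) (K := K) Bool
  obtain ⟨j, e, he⟩ := exists_linearSoficFamily_len_eq (K := K) ((Fin n × Fin m) × Bool)
  have h := (containsProduct_rankLen (ι := Fin n) (κ := Fin m) (K := K)).map e he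
  rw [linearSoficFamily_len_mk, linearSoficFamily_len_mk]
  exact ⟨j, h⟩

theorem linearSoficFamily_admitsExpansions : (linearSoficFamily K).AdmitsExpansions := by
  rintro ⟨n, hn⟩
  have := nonempty_of_nontrivial_GL (ι := Fin n) (K := K)
  have := nontrivial_GL_prod (ι := Fin n) (K := K) (Fin n)
  obtain ⟨j, e, he⟩ := exists_linearSoficFamily_len_eq (K := K) (Fin n × Fin n)
  have h := (containsExpansion_rankLen (ι := Fin n) (K := K)).map e he
  rw [linearSoficFamily_len_mk]
  exact ⟨j, h⟩

end LinearSofic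

end MetricApprox

namespace MetricApprox

/-! ### Unitary groups with the Hilbert-Schmidt metric. -/

section Hyperlinear

open scoped Kronecker

variable {ι κ : Type*} [Fintype ι] [DecidableEq ι] [Fintype κ] [DecidableEq κ]

/-- The normalized Hilbert-Schmidt length on `U(ι)`. -/
noncomputable def hsLen (U : Matrix.unitaryGroup ι ℂ) : ℝ :=
  √((1 / Fintype.card ι : ℝ) * ∑ i, ∑ j, ‖U.1 i j - (1 : Matrix ι ι ℂ) i j‖ ^ 2)

theorem hsLen_nonneg (U : Matrix.unitaryGroup ι ℂ) : 0 ≤ hsLen U := Real.sqrt_nonneg _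

theorem sum_norm_sq_eq_trace {n : Type*} [Fintype n] (X : Matrix n n ℂ) :
    ((∑ i, ∑ j, ‖X i j‖ ^ 2 : ℝ) : ℂ) = (X * star X).trace := by
  simp [Matrix.trace, Matrix.mul_apply, Matrix.star_apply, Complex.mul_conj,
    Complex.normSq_eq_norm_sq]

theorem sum_norm_sub_one_sq (U : Matrix.unitaryGroup ι ℂ) :
    ∑ i, ∑ j, ‖U.1 i j - (1 : Matrix ι ι ℂ) i j‖ ^ 2 =
      2 * Fintype.card ι - 2 * U.1.trace.re := by
  have h1 := sum_norm_sq_eq_trace (U.1 - 1)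
  have h2 : (U.1 - 1) * star (U.1 - 1) = 1 - U.1 - star U.1 + 1 := by
    rw [star_sub, star_one, mul_sub, sub_mul, Matrix.mem_unitaryGroup_iff.1 U.2]
    noncomm_ring
  have h3 : (star U.1).trace = star U.1.trace := Matrix.trace_conjTranspose _
  rw [h2, Matrix.trace_add, Matrix.trace_sub, Matrix.trace_sub, Matrix.trace_one, h3] at h1
  have h4 := congrArg Complex.re h1
  rw [Complex.ofReal_re] at h4
  simp only [Matrix.sub_apply] at h4
  rw [h4]
  simp
  ring

/-- The squared length is affine in the normalized trace. This reduces everything below to traces,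
which add over blocks and multiply over Kronecker products. -/
theorem hsLen_sq [Nonempty ι] (U : Matrix.unitaryGroup ι ℂ) :
    hsLen U ^ 2 = 2 - 2 * (U.1.trace.re / Fintype.card ι) := by
  have hn : (Fintype.card ι : ℝ) ≠ 0 := by positivity
  rw [hsLen, Real.sq_sqrt (by positivity), sum_norm_sub_one_sq]
  field_simp

theorem norm_trace_le (U : Matrix.unitaryGroup ι ℂ) : ‖U.1.trace‖ ≤ Fintype.card ι := by
  refine (norm_sum_le _ _).trans ?_
  refine (Finset.sum_le_sum fun i _ => entry_norm_bound_of_unitary U.2 i i).trans ?_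
  simp

theorem hsLen_le_two [Nonempty ι] (U : Matrix.unitaryGroup ι ℂ) : hsLen U ≤ 2 := by
  have hn : (0 : ℝ) < Fintype.card ι := by positivity
  have h1 := (abs_le.1 ((Complex.abs_re_le_norm _).trans (norm_trace_le U))).1
  have h2 : -1 ≤ U.1.trace.re / Fintype.card ι := by
    rw [le_div_iff₀ hn]
    linarith
  refine le_of_sq_le_sq ?_ (by norm_num)
  rw [hsLen_sq]
  linarith

theorem blockDiagonal_mem_unitaryGroup {A : Type*} [Fintype A] [DecidableEq A]
    {f : A → Matrix ι ι ℂ} (hf : ∀ a, f a ∈ Matrix.unitaryGroup ι ℂ) :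
    Matrix.blockDiagonal f ∈ Matrix.unitaryGroup (ι × A) ℂ := by
  rw [Matrix.mem_unitaryGroup_iff, Matrix.star_eq_conjTranspose,
    Matrix.blockDiagonal_conjTranspose, ← Matrix.blockDiagonal_mul, ← Matrix.blockDiagonal_one]
  exact congrArg _ (funext fun a => Matrix.mem_unitaryGroup_iff.1 (hf a))

theorem blockPermHom_mem_unitaryGroup {A : Type*} [Fintype A] [DecidableEq A]
    (σ : Equiv.Perm A) : blockPermHom ι A ℂ σ ∈ Matrix.unitaryGroup (ι × A) ℂ := by
  have h : star (blockPermHom ι A ℂ σ) = blockPermHom ι A ℂ σ⁻¹ :=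
    Matrix.conjTranspose_permMatrix _
  rw [Matrix.mem_unitaryGroup_iff, h, ← map_mul, mul_inv_cancel, map_one]

theorem trace_blockPermHom {A : Type*} [Fintype A] [DecidableEq A] [Nonempty A]
    (σ : Equiv.Perm A) : (blockPermHom ι A ℂ σ).trace =
      ((Fintype.card ι * (Fintype.card A * (1 - hammingMetric σ 1)) : ℝ) : ℂ) := by
  have h1 (x : ι) (a : A) : blockPermHom ι A ℂ σ (x, a) (x, a) =
      ((1 - if σ a = a then 0 else 1 : ℝ) : ℂ) := by
    have h2 : blockPermHom ι A ℂ σ = (1 : Matrix (ι × A) (ι × A) ℂ).submatrix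
        (Equiv.prodCongr (1 : Equiv.Perm ι) σ⁻¹) id := by
      rw [blockPermHom_eq, ← PEquiv.toMatrix_toPEquiv_mul, mul_one]
    have h3 : σ⁻¹ a = a ↔ σ a = a := by rw [Equiv.Perm.inv_eq_iff_eq, eq_comm]
    rw [h2]
    change (1 : Matrix (ι × A) (ι × A) ℂ) (x, σ⁻¹ a) (x, a) = _
    rw [Matrix.one_apply]
    simp only [Prod.mk.injEq, true_and, h3]
    split_ifs <;> simp
  unfold Matrix.trace
  simp only [Matrix.diag_apply]
  rw [Fintype.sum_prod_type]
  simp only [h1]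
  rw [← Complex.ofReal_sum, Finset.sum_sub_distrib, sum_moved]
  simp
  ring

/-- Here squared lengths average exactly. Cauchy-Schwarz gives the lower bound, `l ^ 2 ≤ 2 * l`
(from `hsLen_le_two`) the upper one, and for permutations the quadratic bound is an equality. -/
theorem containsWreathProduct_hsLen [Nonempty ι] (A : Type) [Fintype A] [DecidableEq A]
    [Nonempty A] :
    ContainsWreathProduct (hsLen : Matrix.unitaryGroup ι ℂ → ℝ) A
      (hsLen : Matrix.unitaryGroup (ι × A) ℂ → ℝ) := by
  let D : (A → Matrix.unitaryGroup ι ℂ) →* Matrix.unitaryGroup (ι × A) ℂ :=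
    { toFun := fun f => ⟨Matrix.blockDiagonal fun a => (f a).1,
        blockDiagonal_mem_unitaryGroup fun a => (f a).2⟩
      map_one' := Subtype.ext Matrix.blockDiagonal_one
      map_mul' := fun f g => Subtype.ext
        (Matrix.blockDiagonal_mul (fun a => (f a).1) (fun a => (g a).1)) }
  let P : Equiv.Perm A →* Matrix.unitaryGroup (ι × A) ℂ :=
    (blockPermHom ι A ℂ).codRestrict _ blockPermHom_mem_unitaryGroup
  have hA : (0 : ℝ) < Fintype.card A := by positivity
  have hn : (0 : ℝ) < Fintype.card ι := by positivity
  have hD (f : A → Matrix.unitaryGroup ι ℂ) :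
      hsLen (D f) ^ 2 = (∑ a, hsLen (f a) ^ 2) / Fintype.card A := by
    have h : (D f).1.trace = ∑ a, (f a).1.trace := by
      change (Matrix.blockDiagonal fun a => (f a).1).trace = _
      exact Matrix.trace_blockDiagonal _
    simp only [hsLen_sq]
    rw [h, Complex.re_sum, Finset.sum_sub_distrib, ← Finset.mul_sum, ← Finset.sum_div,
      Fintype.card_prod]
    simp only [Finset.sum_const, Finset.card_univ, nsmul_eq_mul]
    push_cast
    field_simp
  refine ⟨D, P, fun σ f => Subtype.ext ?_, fun f => ?_, fun f => ?_, fun σ => ?_⟩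
  · exact blockPermHom_mul_blockDiagonal σ _
  · refine le_of_sq_le_sq ?_ (hsLen_nonneg _)
    rw [hD, div_pow, div_le_div_iff₀ (by positivity) hA]
    have h := sq_sum_le_card_mul_sum_sq (s := Finset.univ) (f := fun a => hsLen (f a))
    rw [Finset.card_univ] at h
    nlinarith
  · rw [hD, ← mul_div_assoc, Finset.mul_sum]
    gcongr with a
    nlinarith [hsLen_nonneg (f a), hsLen_le_two (f a)]
  · have h : (P σ).1.trace = _ := trace_blockPermHom σ
    rw [hsLen_sq, h, Complex.ofReal_re, Fintype.card_prod]
    refine le_of_eq ?_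
    push_cast
    field_simp
    ring

theorem containsProduct_hsLen [Nonempty ι] [Nonempty κ] :
    ContainsProduct (hsLen : Matrix.unitaryGroup ι ℂ → ℝ) (hsLen : Matrix.unitaryGroup κ ℂ → ℝ)
      (hsLen : Matrix.unitaryGroup ((ι × κ) × Bool) ℂ → ℝ) := by
  have hmem (x : Matrix.unitaryGroup ι ℂ × Matrix.unitaryGroup κ ℂ) :
      balancedSumHom ι κ ℂ (x.1.1, x.2.1) ∈ Matrix.unitaryGroup ((ι × κ) × Bool) ℂ := by
    refine blockDiagonal_mem_unitaryGroup fun b => ?_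
    cases b
    · exact Matrix.kronecker_mem_unitary (one_mem _) x.2.2
    · exact Matrix.kronecker_mem_unitary x.1.2 (one_mem _)
  let Q : Matrix.unitaryGroup ι ℂ × Matrix.unitaryGroup κ ℂ →*
      Matrix.unitaryGroup ((ι × κ) × Bool) ℂ :=
    { toFun := fun x => ⟨balancedSumHom ι κ ℂ (x.1.1, x.2.1), hmem x⟩
      map_one' := Subtype.ext (map_one (balancedSumHom ι κ ℂ))
      map_mul' := fun x y => Subtype.ext
        (map_mul (balancedSumHom ι κ ℂ) (x.1.1, x.2.1) (y.1.1, y.2.1)) }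
  have hn : (Fintype.card ι : ℝ) ≠ 0 := by positivity
  have hm : (Fintype.card κ : ℝ) ≠ 0 := by positivity
  have hQ (x : Matrix.unitaryGroup ι ℂ × Matrix.unitaryGroup κ ℂ) :
      hsLen (Q x) ^ 2 = (hsLen x.1 ^ 2 + hsLen x.2 ^ 2) / 2 := by
    have h : (Q x).1.trace = x.1.1.trace * Fintype.card κ + Fintype.card ι * x.2.1.trace := by
      change (Matrix.blockDiagonal fun b : Bool =>
        bif b then x.1.1 ⊗ₖ 1 else 1 ⊗ₖ x.2.1).trace = _
      rw [Matrix.trace_blockDiagonal, Fintype.sum_bool]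
      simp only [cond_true, cond_false, Matrix.trace_kronecker, Matrix.trace_one]
    simp only [hsLen_sq]
    rw [h]
    simp only [Fintype.card_prod, Fintype.card_bool, Complex.add_re, Complex.mul_re,
      Complex.natCast_re, Complex.natCast_im, mul_zero, zero_mul, sub_zero]
    push_cast
    field_simp
    ring
  refine ⟨Q, fun x => ?_⟩
  have h1 := hsLen_nonneg x.1
  have h2 := hsLen_nonneg x.2
  constructor
  · refine le_of_sq_le_sq ?_ (hsLen_nonneg _)
    rw [hQ]
    nlinarith [sq_nonneg (hsLen x.1 - hsLen x.2)]
  · refine le_of_sq_le_sq ?_ (by positivity)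
    rw [hQ]
    nlinarith

/-- With `a + b * I` the normalized trace of `U`, that of the tensor square is its square, with real
part `a ^ 2 - b ^ 2`. Dropping `b ^ 2`, the squared length grows at least by the factor `1 + a`,
which is close to `2` for short elements. Lengths thus grow by almost `√2`, which leaves room for `5
/ 4`. -/
theorem containsExpansion_hsLen [Nonempty ι] :
    ContainsExpansion (hsLen : Matrix.unitaryGroup ι ℂ → ℝ)
      (hsLen : Matrix.unitaryGroup (ι × ι) ℂ → ℝ) := by
  let t : Matrix.unitaryGroup ι ℂ →* Matrix.unitaryGroup (ι × ι) ℂ :=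
    { toFun := fun U => ⟨U.1 ⊗ₖ U.1, Matrix.kronecker_mem_unitary U.2 U.2⟩
      map_one' := Subtype.ext Matrix.one_kronecker_one
      map_mul' := fun U V => Subtype.ext (Matrix.mul_kronecker_mul U.1 V.1 U.1 V.1) }
  have hn : (0 : ℝ) < Fintype.card ι := by positivity
  have key (U : Matrix.unitaryGroup ι ℂ) : ∃ a b : ℝ, a ^ 2 + b ^ 2 ≤ 1 ∧
      hsLen U ^ 2 = 2 - 2 * a ∧ hsLen (t U) ^ 2 = 2 - 2 * (a ^ 2 - b ^ 2) := by
    refine ⟨U.1.trace.re / Fintype.card ι, U.1.trace.im / Fintype.card ι, ?_, hsLen_sq U, ?_⟩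
    · have h1 := norm_trace_le U
      have h2 := Complex.sq_norm U.1.trace
      rw [Complex.normSq_apply] at h2
      rw [div_pow, div_pow, ← add_div, div_le_one (by positivity)]
      nlinarith [norm_nonneg U.1.trace]
    · have h : (t U).1.trace = U.1.trace * U.1.trace := Matrix.trace_kronecker _ _
      rw [hsLen_sq, h, Complex.mul_re, Fintype.card_prod]
      push_cast
      field_simp
  refine ⟨t, fun U => ?_⟩
  obtain ⟨a, b, hab, h1, h2⟩ := key U
  have h3 := hsLen_nonneg U
  refine ⟨le_of_sq_le_sq ?_ (by positivity), fun h => le_of_sq_le_sq ?_ (hsLen_nonneg _)⟩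
  · rw [h2, mul_pow, h1]
    nlinarith [sq_nonneg (a - 1)]
  · have h4 : hsLen U ^ 2 ≤ 1 / 36 := by nlinarith
    rw [h2, mul_pow, h1]
    nlinarith [sq_nonneg b, sq_nonneg (a - 1)]

theorem nontrivial_unitaryGroup [Nonempty ι] : Nontrivial (Matrix.unitaryGroup ι ℂ) := by
  refine ⟨1, ⟨-1, by simp [Matrix.mem_unitaryGroup_iff]⟩, fun h => ?_⟩
  obtain ⟨i⟩ := ‹Nonempty ι›
  have h1 : (1 : Matrix ι ι ℂ) i i = (-1 : Matrix ι ι ℂ) i i :=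
    congrFun (congrFun (congrArg Subtype.val h) i) i
  rw [Matrix.neg_apply, Matrix.one_apply_eq] at h1
  norm_num at h1

theorem nonempty_of_nontrivial_unitaryGroup [Nontrivial (Matrix.unitaryGroup ι ℂ)] :
    Nonempty ι := by
  by_contra h
  rw [not_nonempty_iff] at h
  exact not_subsingleton (Matrix.unitaryGroup ι ℂ) inferInstance

theorem exists_hyperlinearFamily_len_eq (ι : Type) [Fintype ι] [DecidableEq ι] [Nonempty ι] :
    ∃ (j : hyperlinearFamily.Idx) (e : Matrix.unitaryGroup ι ℂ →* hyperlinearFamily.G j),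
      ∀ U, hyperlinearFamily.len j (e U) = hsLen U := by
  let r := Matrix.reindexAlgEquiv ℂ ℂ (Fintype.equivFin ι)
  have hr (U : Matrix.unitaryGroup ι ℂ) :
      r U.1 ∈ Matrix.unitaryGroup (Fin (Fintype.card ι)) ℂ := by
    have h : star (r U.1) = r (star U.1) := rfl
    rw [Matrix.mem_unitaryGroup_iff, h, ← map_mul, Matrix.mem_unitaryGroup_iff.1 U.2, map_one]
  let e : Matrix.unitaryGroup ι ℂ →* Matrix.unitaryGroup (Fin (Fintype.card ι)) ℂ :=
    { toFun := fun U => ⟨r U.1, hr U⟩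
      map_one' := Subtype.ext (map_one r)
      map_mul' := fun U V => Subtype.ext (map_mul r U.1 V.1) }
  have : Nonempty (Fin (Fintype.card ι)) := ⟨Fintype.equivFin ι (Classical.arbitrary ι)⟩
  refine ⟨⟨Fintype.card ι, nontrivial_unitaryGroup⟩, e, fun U => ?_⟩
  change √((1 / Fintype.card ι : ℝ) *
    ∑ i, ∑ j, ‖r U.1 i j - (1 : Matrix (Fin (Fintype.card ι)) (Fin (Fintype.card ι)) ℂ) i j‖ ^ 2) =
      _
  rw [← (Fintype.equivFin ι).sum_comp]
  simp only [← (Fintype.equivFin ι).sum_comp]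
  simp [r, hsLen, Matrix.one_apply]

theorem hyperlinearFamily_len_mk {n : ℕ} (hn : Nontrivial (Matrix.unitaryGroup (Fin n) ℂ)) :
    hyperlinearFamily.len ⟨n, hn⟩ = (hsLen : Matrix.unitaryGroup (Fin n) ℂ → ℝ) := by
  funext U
  change _ = √((1 / Fintype.card (Fin n) : ℝ) * _)
  rw [Fintype.card_fin]
  rfl

theorem hyperlinearFamily_admitsWreathProducts : hyperlinearFamily.AdmitsWreathProducts := by
  rintro ⟨n, hn⟩ A _ _ _
  have := nonempty_of_nontrivial_unitaryGroup (ι := Fin n)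
  obtain ⟨j, e, he⟩ := exists_hyperlinearFamily_len_eq (Fin n × A)
  have h := (containsWreathProduct_hsLen (ι := Fin n) A).map e he
  rw [hyperlinearFamily_len_mk]
  exact ⟨j, h⟩

theorem hyperlinearFamily_admitsProducts : hyperlinearFamily.AdmitsProducts := by
  rintro ⟨n, hn⟩ ⟨m, hm⟩
  have := nonempty_of_nontrivial_unitaryGroup (ι := Fin n)
  have := nonempty_of_nontrivial_unitaryGroup (ι := Fin m)
  obtain ⟨j, e, he⟩ := exists_hyperlinearFamily_len_eq ((Fin n × Fin m) × Bool)
  have h := (containsProduct_hsLen (ι := Fin n) (κ := Fin m)).map e he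
  rw [hyperlinearFamily_len_mk, hyperlinearFamily_len_mk]
  exact ⟨j, h⟩

theorem hyperlinearFamily_admitsExpansions : hyperlinearFamily.AdmitsExpansions := by
  rintro ⟨n, hn⟩
  have := nonempty_of_nontrivial_unitaryGroup (ι := Fin n)
  obtain ⟨j, e, he⟩ := exists_hyperlinearFamily_len_eq (Fin n × Fin n)
  have h := (containsExpansion_hsLen (ι := Fin n)).map e he
  rw [hyperlinearFamily_len_mk]
  exact ⟨j, h⟩

end Hyperlinear

end MetricApprox
theorem mainTheorem2 (Γ : Type u) [Group Γ] (Δ : Type v) [Group Δ]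
    (β : Γ →* MulAut Δ) :
    (MetricApprox.IsSofic Γ → MetricApprox.IsSofic Δ →
      MetricApprox.IsSoficAction (fun (Λ : Type w) [Group Λ] => MetricApprox.IsSofic Λ) β →
      MetricApprox.IsSofic (Δ ⋊[β] Γ)) ∧
    (∀ (K : Type x) [Field K],
      MetricApprox.IsLinearSofic K Γ → MetricApprox.IsLinearSofic K Δ →
      MetricApprox.IsSoficAction
        (fun (Λ : Type w) [Group Λ] => MetricApprox.IsLinearSofic K Λ) β →
      MetricApprox.IsLinearSofic K (Δ ⋊[β] Γ)) ∧
    (MetricApprox.IsHyperlinear Γ → MetricApprox.IsHyperlinear Δ →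
      MetricApprox.IsSoficAction (fun (Λ : Type w) [Group Λ] => MetricApprox.IsHyperlinear Λ) β →
      MetricApprox.IsHyperlinear (Δ ⋊[β] Γ)) ∧
    (MetricApprox.IsWeaklySofic Γ → MetricApprox.IsWeaklySofic Δ →
      MetricApprox.IsSoficAction (fun (Λ : Type w) [Group Λ] => MetricApprox.IsWeaklySofic Λ) β →
      MetricApprox.IsWeaklySofic (Δ ⋊[β] Γ)) := by
  refine ⟨fun hΓ _ hβ => ?_, fun K _ hΓ _ hβ => ?_, fun hΓ _ hβ => ?_, fun hΓ _ hβ => ?_⟩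
  · exact hΓ.semidirectProduct MetricApprox.soficFamily_admitsWreathProducts
      MetricApprox.soficFamily_admitsProducts MetricApprox.soficFamily_admitsExpansions hβ
  · exact hΓ.semidirectProduct MetricApprox.linearSoficFamily_admitsWreathProducts
      MetricApprox.linearSoficFamily_admitsProducts
      MetricApprox.linearSoficFamily_admitsExpansions hβ
  · exact hΓ.semidirectProduct MetricApprox.hyperlinearFamily_admitsWreathProducts
      MetricApprox.hyperlinearFamily_admitsProducts
      MetricApprox.hyperlinearFamily_admitsExpansions hβ
  · exact hΓ.semidirectProduct MetricApprox.weaklySoficFamily_admitsWreathProducts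
      MetricApprox.weaklySoficFamily_admitsProducts
      MetricApprox.weaklySoficFamily_admitsExpansions hβ
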